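/- Let $\mathfrak S$ be a finite set not containing $0$, and let $e\ge 0$ be an integer. For a profinite group $G$, let $\mathrm{Subgr}(G)=\varprojlim_N \mathrm{Subgr}(G/N)$ ($N$ open normal) be the profinite space of closed subgroups of $G$; homomorphisms of profinite groups are continuous. For a cardinal $\kappa$, $\mathrm{rk}(G)\le\kappa$ means that $G$ is topologically generated by a set of at most $\kappa$ elements that converges to $1$ (every open normal subgroup contains all but finitely many of them). **Group piles.** A *group pile* $\mathbf G=(G,\mathcal G_0,\mathcal G_{\mathfrak p})_{\mathfrak p\in\mathfrak S}$ consists of a profinite group $G$, a nonempty closed conjugation-invariant set $\mathcal G_0\subseteq \mathrm{Subgr}(G)$ whose elements are pairwise conjugate in $G$, and a closed conjugation-invariant set $\mathcal G_{\mathfrak p}\subseteq\mathrm{Subgr}(G)$ for each $\mathfrak p\in\mathfrak S$. It is *deficient* if $\mathcal G_0=\{1\}$, and *finite* if $G$ is finite. Let $G'$ be the closed subgroup generated by all $\Gamma\in\bigcup_{\mathfrak p\in\mathfrak S}\mathcal G_{\mathfrak p}$; $\mathbf G$ is *$e$-generated* if $\mathrm{rk}(G/G')\le e$. An *epimorphism*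 $f:\mathbf G\to\mathbf H$ is a surjective homomorphism $f:G\to H$ of profinite groups with $f(\mathcal G_{\mathfrak p})=\mathcal H_{\mathfrak p}$ for every $\mathfrak p\in\{0\}\cup\mathfrak S$; it is *rigid* if $f|_\Gamma$ is injective for every $\Gamma\in\bigcup_{\mathfrak p\in\mathfrak S}\mathcal G_{\mathfrak p}$. **Embedding problems.** An *embedding problem* for $\mathbf G$ is a pair of epimorphisms $(\varphi:\mathbf G\to\mathbf A,\ \alpha:\mathbf B\to\mathbf A)$ of group piles. It is called rigid if $\alpha$ is rigid, and $e$-generated, deficient or finite if $\mathbf B$ is. It is *solvable* if there is an epimorphism $\gamma:\mathbf G\to\mathbf B$ of group piles with $\alpha\circ\gamma=\varphi$. An *$e$-free C-pile* is an $e$-generated deficient group pile for which every rigid $e$-generated deficient finite embedding problem is solvable. **Cosaturation.** Let $S(\mathbf G)=\biguplus_N G/N$ ($N$ open normal in $G$), a structure for the language with relations $\le,\sqsubseteq,P,G_n,\mathcal G_{\mathfrak p,n}$ ($n\in\mathbb N$, $\mathfrak p\in\mathfrak S$), where - $x_1N_1\le x_2N_2$ iff $N_1\subseteq N_2$; - $x_1N_1\sqsubseteq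 x_2N_2$ iff $x_1N_1\subseteq x_2N_2$; - $(x_1N_1,x_2N_2,x_3N_3)\in P$ iff $N_1=N_2=N_3$ and $x_1x_2N_1=x_3N_1$; - $xN\in G_n$ iff $(G:N)\le n$; - $(x_1N_1,\dots,x_nN_n)\in\mathcal G_{\mathfrak p,n}$ iff $N_1=\dots=N_n$, $(G:N_1)\le n$, and $\Gamma N_1/N_1=\{x_1N_1,\dots,x_nN_n\}$ for some $\Gamma\in\mathcal G_{\mathfrak p}$. A *coformula* is a first-order formula of this language in which all quantifiers are bounded, i.e. range over some $G_n$. A set $\Sigma$ of coformulas with parameters in $S(\mathbf G)$ is *ranked* if for every variable $v$ occurring freely in a member of $\Sigma$ there is $n$ with $G_n(v)\in\Sigma$; it is *cosatisfied* in $\mathbf G$ if some assignment of elements of $S(\mathbf G)$ to its free variables makes all members of $\Sigma$ true in $S(\mathbf G)$. $\mathbf G$ is *$\aleph_1$-cosaturated* if every ranked set $\Sigma$ of coformulas with parameters in $S(\mathbf G)$ with $|\Sigma|<\aleph_1$, all of whose finite subsets are cosatisfied in $\mathbf G$, is itself cosatisfied in $\mathbf G$. **Proposition.** Let $\mathbf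 G$ be an $\aleph_1$-cosaturated $e$-free C-pile. Then every rigid, $e$-generated, deficient embedding problem $(\varphi:\mathbf G\to\mathbf A,\ \alpha:\mathbf B\to\mathbf A)$ for $\mathbf G$ with $\mathrm{rk}(\mathbf B)=\mathrm{rk}(B)\le\aleph_0$ is solvable. -/

import Mathlib

universe u v w

open scoped Topology

namespace Pile

/-! ### Closed subgroups of a profinite group -/

/-- The topology on the set `Subgr(G)` of closed subgroups, transported from
`lim_N Subgr(G/N)`, where `N` runs over the open normal subgroups and each finite set
`Subgr(G/N)` is discrete: it is the coarsest topology making all maps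
`Γ ↦ Γ N / N` (to a discrete space) continuous. -/
instance subgrTopology (G : Type u) [Group G] [TopologicalSpace G] :
    TopologicalSpace (ClosedSubgroup G) :=
  ⨅ N : OpenNormalSubgroup G,
    TopologicalSpace.induced
      (fun Γ : ClosedSubgroup G => Γ.toSubgroup.map (QuotientGroup.mk' N.toSubgroup)) ⊥

/-- The map `Subgr(f) : Subgr(G) → Subgr(H)`, `Γ ↦ f(Γ)`. -/
def subgrMap {G : Type u} {H : Type w} [Group G] [TopologicalSpace G] [CompactSpace G]
    [Group H] [TopologicalSpace H] [T2Space H] (f : G →ₜ* H) (Γ : ClosedSubgroup G) :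
    ClosedSubgroup H where
  toSubgroup := Γ.toSubgroup.map f.toMonoidHom
  isClosed' := (Γ.isClosed'.isCompact.image f.continuous_toFun).isClosed

/-- The inner automorphism `x ↦ g x g⁻¹`. -/
def conjHom {G : Type u} [Group G] [TopologicalSpace G] [IsTopologicalGroup G] (g : G) :
    G →ₜ* G where
  toMonoidHom := (MulAut.conj g).toMonoidHom
  continuous_toFun := IsTopologicalGroup.continuous_conj g

/-- `X` converges to `1`: every open normal subgroup contains all but finitely many
elements of `X`. -/
def ConvergesToOne {G : Type u} [Group G] [TopologicalSpace G] (X : Set G) : Prop :=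
  ∀ N : OpenNormalSubgroup G, (X \ (N : Set G)).Finite

/-- `rk(G) ≤ κ`, where the rank of a profinite group `G` is the least cardinality of a set of
topological generators of `G` converging to `1`. -/
def RankLE (G : Type u) [Group G] [TopologicalSpace G] [IsTopologicalGroup G]
    (κ : Cardinal.{u}) : Prop :=
  ∃ X : Set G, ConvergesToOne X ∧ (Subgroup.closure X).topologicalClosure = ⊤ ∧
    Cardinal.mk X ≤ κ

end Pile

/-! ### Group piles -/

/-- A group pile `(G, 𝒢₀, 𝒢_p)_{p ∈ S}`. The index set `{0} ∪ S` is `Option S`: `none` stands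
for `0`, and `some p` for `p ∈ S`. -/
structure GroupPile (S : Type v) where
  carrier : ProfiniteGrp.{u}
  subgroups : Option S → Set (ClosedSubgroup carrier)
  isClosed_subgroups : ∀ i, IsClosed (subgroups i)
  conj_mem : ∀ i, ∀ Γ ∈ subgroups i, ∀ g : carrier, Pile.subgrMap (Pile.conjHom g) Γ ∈ subgroups i
  zero_nonempty : (subgroups none).Nonempty
  zero_conj : ∀ Γ ∈ subgroups none, ∀ Δ ∈ subgroups none,
    ∃ g : carrier, Δ = Pile.subgrMap (Pile.conjHom g) Γ

namespace GroupPile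

variable {S : Type v}

/-- `𝒢₀ = {1}`. -/
def IsDeficient (G : GroupPile.{u} S) : Prop :=
  G.subgroups none = {Γ | Γ.toSubgroup = ⊥}

/-- The closed subgroup `G'` generated by the members of the `𝒢_p`, `p ∈ S`. -/
def genSubgroup (G : GroupPile.{u} S) : Subgroup G.carrier :=
  (⨆ (p : S) (Γ ∈ G.subgroups (some p)), Γ.toSubgroup).topologicalClosure

instance genSubgroup_normal (G : GroupPile.{u} S) : G.genSubgroup.Normal := by
  have h : (⨆ (p : S) (Γ ∈ G.subgroups (some p)), Γ.toSubgroup).Normal := by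
    constructor
    intro n hn g
    have key : (⨆ (p : S) (Γ ∈ G.subgroups (some p)), Γ.toSubgroup) ≤
        (⨆ (p : S) (Γ ∈ G.subgroups (some p)), Γ.toSubgroup).comap
          (MulAut.conj g).toMonoidHom := by
      refine iSup_le fun p => iSup_le fun Γ => iSup_le fun hΓ => ?_
      rw [← Subgroup.map_le_iff_le_comap]
      exact le_iSup_of_le p (le_iSup_of_le (Pile.subgrMap (Pile.conjHom g) Γ)
        (le_iSup_of_le (G.conj_mem _ Γ hΓ g) le_rfl))
    exact key hn
  exact Subgroup.is_normal_topologicalClosure _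

/-- `G` is `e`-generated: the quotient `G / G'` has rank at most `e`. -/
def IsEGenerated (G : GroupPile.{u} S) (e : ℕ) : Prop :=
  Pile.RankLE (G.carrier ⧸ G.genSubgroup) (e : Cardinal.{u})

/-- Epimorphisms of group piles: continuous surjective homomorphisms `f : G → H` with
`f(𝒢_i) = ℋ_i` for each `i ∈ {0} ∪ S`. -/
def IsEpi (G H : GroupPile.{u} S) (f : G.carrier →ₜ* H.carrier) : Prop :=
  Function.Surjective f ∧ ∀ i, Pile.subgrMap f '' G.subgroups i = H.subgroups i

/-- `f` is rigid: its restriction to each member of each `𝒢_p`, `p ∈ S`, is injective. -/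
def IsRigid (G H : GroupPile.{u} S) (f : G.carrier →ₜ* H.carrier) : Prop :=
  ∀ p : S, ∀ Γ ∈ G.subgroups (some p), Set.InjOn f (Γ : Set G.carrier)

/-! ### Embedding problems -/

/-- An embedding problem for `G`: a pair of epimorphisms `φ : G → A`, `α : B → A`. -/
structure EmbeddingProblem (G : GroupPile.{u} S) where
  A : GroupPile.{u} S
  B : GroupPile.{u} S
  φ : G.carrier →ₜ* A.carrier
  α : B.carrier →ₜ* A.carrier
  isEpi_φ : IsEpi G A φ
  isEpi_α : IsEpi B A α

namespace EmbeddingProblem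

variable {G : GroupPile.{u} S}

def Rigid (E : EmbeddingProblem G) : Prop := IsRigid E.B E.A E.α

def EGenerated (E : EmbeddingProblem G) (e : ℕ) : Prop := E.B.IsEGenerated e

def Deficient (E : EmbeddingProblem G) : Prop := E.B.IsDeficient

def FiniteTarget (E : EmbeddingProblem G) : Prop := Finite E.B.carrier

/-- There is an epimorphism of group piles `γ : G → B` with `α ∘ γ = φ`. -/
def Solvable (E : EmbeddingProblem G) : Prop :=
  ∃ γ : G.carrier →ₜ* E.B.carrier, IsEpi G E.B γ ∧ ∀ x, E.α (γ x) = E.φ x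

end EmbeddingProblem

/-- An `e`-free C-pile. -/
def IsFreeCPile (G : GroupPile.{u} S) (e : ℕ) : Prop :=
  G.IsEGenerated e ∧ G.IsDeficient ∧
    ∀ E : EmbeddingProblem G, E.Rigid → E.EGenerated e → E.Deficient → E.FiniteTarget → E.Solvable

end GroupPile

/-! ### The colanguage and the structure `S(G)` -/

namespace Pile

/-- The relation symbols of the colanguage: `≤`, `⊑`, `P`, `G_n`, `𝒢_{p,n}`. -/
inductive CoRel (S : Type v) : ℕ → Type v
  | le : CoRel S 2
  | sub : CoRel S 2
  | prod : CoRel S 3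
  | idx (n : ℕ) : CoRel S 1
  | loc (p : S) (n : ℕ) : CoRel S n

/-- The colanguage (purely relational). -/
def coLang (S : Type v) : FirstOrder.Language.{0, v} where
  Functions := fun _ => Empty
  Relations := CoRel S

end Pile

namespace GroupPile

variable {S : Type v}

/-- The disjoint union of the quotients `G / N`, `N` open normal in `G`. -/
def CoSys (G : GroupPile.{u} S) : Type u :=
  Σ N : OpenNormalSubgroup G.carrier, G.carrier ⧸ N.toSubgroup

/-- An element of `S(G)` as a coset, i.e. as a subset of `G`. -/
def CoSys.coset {G : GroupPile.{u} S} (x : G.CoSys) : Set G.carrier :=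
  {g | (QuotientGroup.mk g : G.carrier ⧸ x.1.toSubgroup) = x.2}

/-- Interpretation of the relation symbols of the colanguage in `S(G)`. -/
def coRelMap (G : GroupPile.{u} S) : ∀ {k : ℕ}, Pile.CoRel S k → (Fin k → G.CoSys) → Prop
  | _, .le, x => (x 0).1 ≤ (x 1).1
  | _, .sub, x => (x 0).coset ⊆ (x 1).coset
  | _, .prod, x => ∃ (N : OpenNormalSubgroup G.carrier) (a b : G.carrier ⧸ N.toSubgroup),
      x 0 = ⟨N, a⟩ ∧ x 1 = ⟨N, b⟩ ∧ x 2 = ⟨N, a * b⟩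
  | _, .idx n, x => (x 0).1.toSubgroup.index ≤ n
  | k, .loc p _, x => ∃ N : OpenNormalSubgroup G.carrier, N.toSubgroup.index ≤ k ∧
      ∃ y : Fin k → G.carrier ⧸ N.toSubgroup, (∀ i, x i = ⟨N, y i⟩) ∧
        ∃ Γ ∈ G.subgroups (some p),
          (QuotientGroup.mk : G.carrier → G.carrier ⧸ N.toSubgroup) '' (Γ : Set G.carrier) =
            Set.range y

instance coStructure (G : GroupPile.{u} S) : (Pile.coLang S).Structure G.CoSys where
  funMap := fun f _ => Empty.elim f
  RelMap := fun R x => G.coRelMap R x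

end GroupPile

/-! ### Coformulas and cosaturation -/

namespace Pile

/-- Coformulas: all quantifiers are bounded, i.e. of the form `∀ v ∈ G_m`. (In `BoundedFormula`
the connectives are `⊥`, `→`, `∀`; a bounded existential quantifier `∃ v ∈ G_m` is
`¬ ∀ v ∈ G_m, ¬`.) -/
inductive IsCoformula {S : Type v} {β : Type w} :
    ∀ {n : ℕ}, (coLang S).BoundedFormula β n → Prop
  | falsum (n : ℕ) : IsCoformula (FirstOrder.Language.BoundedFormula.falsum (n := n))
  | equal {n : ℕ} (t₁ t₂ : (coLang S).Term (β ⊕ Fin n)) :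
      IsCoformula (FirstOrder.Language.BoundedFormula.equal t₁ t₂)
  | rel {n l : ℕ} (R : (coLang S).Relations l) (ts : Fin l → (coLang S).Term (β ⊕ Fin n)) :
      IsCoformula (FirstOrder.Language.BoundedFormula.rel R ts)
  | imp {n : ℕ} {f g : (coLang S).BoundedFormula β n} :
      IsCoformula f → IsCoformula g → IsCoformula (f.imp g)
  | ball {n : ℕ} (m : ℕ) {f : (coLang S).BoundedFormula β (n + 1)} :
      IsCoformula f →
      IsCoformula
        ((FirstOrder.Language.Relations.boundedFormula₁ (L := coLang S) (CoRel.idx m)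
          (FirstOrder.Language.Term.var (Sum.inr (Fin.last n)))).imp f).all

/-- The formula `G_n(v)`. -/
def idxFormula {S : Type v} {β : Type w} (n : ℕ) (v : β) : (coLang S).Formula β :=
  FirstOrder.Language.Relations.formula₁ (L := coLang S) (CoRel.idx n) (FirstOrder.Language.Term.var v)

open Classical in
/-- A set of formulas with free variables from `V` and parameters from `M` (both are treated as
free variables, in `M ⊕ V`) is ranked if for every variable `v ∈ V` that occurs in one of its
members, it contains `G_n(v)` for some `n`. -/
def IsRanked {S : Type v} {M : Type u} {V : Type w}
    (Φ : Set ((coLang S).Formula (M ⊕ V))) : Prop :=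
  ∀ f ∈ Φ, ∀ v : V, Sum.inr v ∈ FirstOrder.Language.BoundedFormula.freeVarFinset f →
    ∃ n : ℕ, idxFormula n (Sum.inr v) ∈ Φ

end Pile

namespace GroupPile

variable {S : Type v}

/-- `Φ` is cosatisfied in `G`; the parameters are interpreted by themselves. -/
def Cosatisfies (G : GroupPile.{u} S) {V : Type w}
    (Φ : Set ((Pile.coLang S).Formula (G.CoSys ⊕ V))) : Prop :=
  ∃ x : V → G.CoSys, ∀ f ∈ Φ, FirstOrder.Language.Formula.Realize f (Sum.elim id x)

/-- `G` is `κ`-cosaturated: a ranked set of fewer than `κ` coformulas with parameters in `S(G)`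
is cosatisfied in `G` if all its finite subsets are. -/
def IsCosaturated (G : GroupPile.{u} S) (κ : Cardinal.{w}) : Prop :=
  ∀ (V : Type w) (Φ : Set ((Pile.coLang S).Formula (G.CoSys ⊕ V))),
    (∀ f ∈ Φ, Pile.IsCoformula f) → Pile.IsRanked Φ →
    Cardinal.mk Φ < Cardinal.lift.{max u v} κ →
    (∀ Φ₀ ⊆ Φ, Φ₀.Finite → G.Cosatisfies Φ₀) →
    G.Cosatisfies Φ

end GroupPile

/-! Write B as the inverse limit of its finite quotients. A solution of the embedding problem
amounts to a compatible family of epimorphisms from G onto the quotients B/N that lift the maps from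
G to the quotients A/L, where (N, L) runs over a cofinal set of pairs. Each finite problem (G → A/L,
B/N → A/L) is solvable by the C-pile property as soon as B/N → A/L is rigid; the difficulty is to
choose the solutions compatibly, and cosaturation does this.

Rigid pairs are cofinal (`Rigid.exists_rigidAt`): for a single local subgroup, injectivity of α is
visible at a finite level, the same level works nearby in Subgr(B), and each set of local subgroups
is compact (`compactSpace_closedSubgroup`). As B has countable rank, it has only countably many open
normal subgroups (`RankLE.countable_openNormalSubgroup`), so there are countably many pairs.

An epimorphism from G onto a finite group F is the same thing as its family of fibers, a tuple in
S(G) that satisfies the multiplication table of F (`exists_eq_fiber`). Hence a compatible system of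
solutions is an assignment satisfying countably many quantifier-free coformulas, with the fibers of
G → A/L as parameters. Finitely many of them only concern pairs above one pair k, and a solution at
k pushes forward to all of these. Cosaturation gives the whole system (`exists_isSystem_univ`), and
compactness shows that its limit is an epimorphism of piles (`IsSystem.solvable`). -/

namespace Pile

/-! ### The space of closed subgroups is compact -/

section SubgrTopology

variable {G : Type u} [Group G] [TopologicalSpace G]

theorem map_mk_eq_map_mk_iff {N : OpenNormalSubgroup G} {Γ Δ : Subgroup G} :
    Γ.map (QuotientGroup.mk' N.toSubgroup) = Δ.map (QuotientGroup.mk' N.toSubgroup) ↔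
      Γ ⊔ N.toSubgroup = Δ ⊔ N.toSubgroup := by
  rw [Subgroup.map_eq_map_iff, QuotientGroup.ker_mk']

theorem sup_eq_sup_of_le {N M : OpenNormalSubgroup G} (h : N ≤ M) {Γ Δ : Subgroup G}
    (e : Γ ⊔ N.toSubgroup = Δ ⊔ N.toSubgroup) : Γ ⊔ M.toSubgroup = Δ ⊔ M.toSubgroup := by
  have h' : N.toSubgroup ≤ M.toSubgroup := h
  rw [← sup_eq_right.2 h', ← sup_assoc, ← sup_assoc, e]

/-- The condition at N ⊓ M implies those at N and at M, so the subbasic neighbourhoods are already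
directed. -/
theorem hasBasis_nhds_closedSubgroup (Γ : ClosedSubgroup G) :
    (𝓝 Γ).HasBasis (fun _ : OpenNormalSubgroup G => True)
      (fun N => {Δ | Δ.toSubgroup ⊔ N.toSubgroup = Γ.toSubgroup ⊔ N.toSubgroup}) := by
  have h : 𝓝 Γ = ⨅ N : OpenNormalSubgroup G,
      Filter.principal {Δ : ClosedSubgroup G |
        Δ.toSubgroup ⊔ N.toSubgroup = Γ.toSubgroup ⊔ N.toSubgroup} := by
    rw [nhds_iInf]
    refine iInf_congr fun N => ?_
    rw [@nhds_induced _ _ ⊥, @nhds_discrete _ ⊥ (@DiscreteTopology.mk _ ⊥ rfl), ← Filter.principal_singleton, Filter.comap_principal]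
    congr 1
    ext Δ
    exact map_mk_eq_map_mk_iff
  rw [h]
  have : Nonempty (OpenNormalSubgroup G) := ⟨⟨⟨⊤, isOpen_univ⟩, inferInstance⟩⟩
  refine Filter.hasBasis_iInf_principal fun N M => ⟨N ⊓ M, ?_, ?_⟩
  · exact fun Δ hΔ => sup_eq_sup_of_le inf_le_left hΔ
  · exact fun Δ hΔ => sup_eq_sup_of_le inf_le_right hΔ

theorem isOpen_sup_eq (N : OpenNormalSubgroup G) (H : Subgroup G) :
    IsOpen {Γ : ClosedSubgroup G | Γ.toSubgroup ⊔ N.toSubgroup = H} := by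
  rw [isOpen_iff_mem_nhds]
  intro Γ hΓ
  have hΓ' : Γ.toSubgroup ⊔ N.toSubgroup = H := hΓ
  rw [← hΓ']
  exact (hasBasis_nhds_closedSubgroup Γ).mem_of_mem trivial

variable [IsTopologicalGroup G] [CompactSpace G]

/-- Each Subgr(G/N) is finite, so along an ultrafilter the value ΓN is eventually a constant H N.
The intersection of the H N is the limit. -/
instance compactSpace_closedSubgroup : CompactSpace (ClosedSubgroup G) := by
  refine ⟨isCompact_iff_ultrafilter_le_nhds.2 fun U _ => ?_⟩
  have key : ∀ N : OpenNormalSubgroup G, ∃ H : Subgroup G,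
      {Γ : ClosedSubgroup G | Γ.toSubgroup ⊔ N.toSubgroup = H} ∈ U := by
    intro N
    have : Finite (G ⧸ N.toSubgroup) := Subgroup.quotient_finite_of_isOpen _ N.isOpen'
    obtain ⟨D, hD⟩ := (U.map
      (fun Γ : ClosedSubgroup G =>
        Γ.toSubgroup.map (QuotientGroup.mk' N.toSubgroup))).eq_pure_of_finite
    have hm : {D} ∈ U.map (fun Γ : ClosedSubgroup G =>
        Γ.toSubgroup.map (QuotientGroup.mk' N.toSubgroup)) := by
      rw [hD]; exact Ultrafilter.mem_pure.2 rfl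
    refine ⟨D.comap (QuotientGroup.mk' N.toSubgroup), Filter.mem_of_superset
      (Ultrafilter.mem_map.1 hm) ?_⟩
    intro Γ hΓ
    have hΓ' : Γ.toSubgroup.map (QuotientGroup.mk' N.toSubgroup) = D := hΓ
    show Γ.toSubgroup ⊔ N.toSubgroup = _
    rw [← hΓ', Subgroup.comap_map_eq, QuotientGroup.ker_mk']
  choose H hH using key
  have hNH : ∀ N, N.toSubgroup ≤ H N := by
    intro N
    obtain ⟨Γ, hΓ⟩ := U.nonempty_of_mem (hH N)
    have hΓ' : Γ.toSubgroup ⊔ N.toSubgroup = H N := hΓ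
    exact hΓ' ▸ le_sup_right
  have hclosed : ∀ N, IsClosed (H N : Set G) := fun N =>
    Subgroup.isClosed_of_isOpen _ (Subgroup.isOpen_mono (hNH N) N.isOpen')
  have hmono : ∀ N M, N ≤ M → H N ≤ H M := by
    intro N M h
    obtain ⟨Γ, h1, h2⟩ := U.nonempty_of_mem (Filter.inter_mem (hH N) (hH M))
    have h1' : Γ.toSubgroup ⊔ N.toSubgroup = H N := h1
    have h2' : Γ.toSubgroup ⊔ M.toSubgroup = H M := h2
    rw [← h1', ← h2']
    exact sup_le_sup_left (α := Subgroup G) h _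
  let Γ₀ : ClosedSubgroup G :=
    ⟨⨅ N, H N, by
      show IsClosed ((⨅ N, H N : Subgroup G) : Set G)
      rw [Subgroup.coe_iInf]; exact isClosed_iInter hclosed⟩
  refine ⟨Γ₀, trivial, (hasBasis_nhds_closedSubgroup Γ₀).ge_iff.2 fun N _ => ?_⟩
  have h0 : Γ₀.toSubgroup ⊔ N.toSubgroup = H N := by
    refine le_antisymm (sup_le (iInf_le _ N) (hNH N)) fun x hx => ?_
    -- A common point of the closed sets H M ∩ xN lies in Γ₀ and is congruent to x modulo N. Each of
    -- these sets is nonempty because some Γ realizes H N and H M simultaneously.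
    have hne : (⋂ M, ((H M : Set G) ∩ {y | x⁻¹ * y ∈ N.toSubgroup})).Nonempty := by
      have : Nonempty (OpenNormalSubgroup G) := ⟨N⟩
      have hc : IsClosed {y | x⁻¹ * y ∈ N.toSubgroup} :=
        (Subgroup.isClosed_of_isOpen _ N.isOpen').preimage (continuous_const_mul x⁻¹)
      refine IsCompact.nonempty_iInter_of_directed_nonempty_isCompact_isClosed _ ?_ ?_
        (fun M => ((hclosed M).inter hc).isCompact) (fun M => (hclosed M).inter hc)
      · intro M M'
        exact ⟨M ⊓ M', Set.inter_subset_inter_left _ (hmono _ _ inf_le_left),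
          Set.inter_subset_inter_left _ (hmono _ _ inf_le_right)⟩
      · intro M
        obtain ⟨Γ, h1, h2⟩ := U.nonempty_of_mem (Filter.inter_mem (hH N) (hH M))
        have h1' : Γ.toSubgroup ⊔ N.toSubgroup = H N := h1
        have h2' : Γ.toSubgroup ⊔ M.toSubgroup = H M := h2
        rw [← h1', Subgroup.mem_sup_of_normal_right] at hx
        obtain ⟨y, hy, z, hz, rfl⟩ := hx
        refine ⟨y, ?_, ?_⟩
        · rw [← h2']; exact Subgroup.mem_sup_left hy
        · show (y * z)⁻¹ * y ∈ N.toSubgroup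
          simpa using hz
    obtain ⟨y, hy⟩ := hne
    rw [Set.mem_iInter] at hy
    have hyN : x⁻¹ * y ∈ N.toSubgroup := (hy N).2
    have hyΓ : y ∈ Γ₀.toSubgroup := Subgroup.mem_iInf.2 fun M => (hy M).1
    have : x = y * (x⁻¹ * y)⁻¹ := by group
    rw [this]
    exact Subgroup.mul_mem_sup hyΓ (inv_mem hyN)
  rw [h0]
  exact hH N

end SubgrTopology

/-! ### Rank and the number of open normal subgroups -/

section Rank

variable {G : Type u} [Group G] [TopologicalSpace G] [IsTopologicalGroup G]

/-- For finite n the generating set is finite, so convergence to 1 is automatic for its image. -/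
theorem RankLE.of_surjective {H : Type u} [Group H] [TopologicalSpace H] [IsTopologicalGroup H]
    {n : ℕ} (h : RankLE G (n : Cardinal.{u})) (f : G →* H) (hf : Continuous f)
    (hs : Function.Surjective f) : RankLE H (n : Cardinal.{u}) := by
  obtain ⟨X, -, hX, hc⟩ := h
  have hXf : X.Finite := Cardinal.lt_aleph0_iff_set_finite.1 (hc.trans_lt (Cardinal.natCast_lt_aleph0))
  refine ⟨f '' X, fun N => (hXf.image f).subset Set.sdiff_subset, ?_, Cardinal.mk_image_le.trans hc⟩
  rw [← MonoidHom.map_closure]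
  exact DenseRange.topologicalClosure_map_subgroup hf hs.denseRange hX

/-- N is the kernel of a homomorphism into some Perm(Fin n). That homomorphism is determined by its
values on the generators, and all but finitely many of these lie in N. So N is encoded by a finite
subset of the countable set X × Perm(Fin n). -/
theorem RankLE.countable_openNormalSubgroup [CompactSpace G] (h : RankLE G Cardinal.aleph0) :
    Countable (OpenNormalSubgroup G) := by
  obtain ⟨X, hX1, hX, hc⟩ := h
  have : Countable X := Cardinal.mk_le_aleph0_iff.1 hc
  have key : ∀ N : OpenNormalSubgroup G, ∃ (n : ℕ) (ρ : G →* Equiv.Perm (Fin n)),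
      ρ.ker = N.toSubgroup := by
    intro N
    have : Finite (G ⧸ N.toSubgroup) := Subgroup.quotient_finite_of_isOpen _ N.isOpen'
    refine ⟨Nat.card (G ⧸ N.toSubgroup), (Finite.equivFin (G ⧸ N.toSubgroup)).permCongrHom.toMonoidHom.comp
      (MulAction.toPermHom G (G ⧸ N.toSubgroup)), ?_⟩
    rw [MonoidHom.ker_comp_of_injective _ _ (MulEquiv.injective _), ← Subgroup.normalCore_eq_ker,
      Subgroup.normalCore_eq_self]
  choose n ρ hρ using key
  let graph : ∀ N : OpenNormalSubgroup G, Set (X × Equiv.Perm (Fin (n N))) :=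
    fun N => {z | (z.1 : G) ∉ N.toSubgroup ∧ z.2 = ρ N z.1}
  have hfin : ∀ N, (graph N).Finite := by
    intro N
    have h1 : {x : X | (x : G) ∉ N.toSubgroup}.Finite :=
      ((hX1 N).preimage Subtype.val_injective.injOn).subset fun x hx => ⟨x.2, hx⟩
    refine (h1.image fun x : X => (x, ρ N (x : G))).subset ?_
    rintro ⟨x, y⟩ ⟨hx, hy⟩
    exact ⟨x, hx, Prod.ext rfl hy.symm⟩
  let F : OpenNormalSubgroup G → Σ m : ℕ, Finset (X × Equiv.Perm (Fin m)) :=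
    fun N => ⟨n N, (hfin N).toFinset⟩
  have main : ∀ (N M : OpenNormalSubgroup G) (m : ℕ) (σ τ : G →* Equiv.Perm (Fin m)),
      σ.ker = N.toSubgroup → τ.ker = M.toSubgroup →
      (∀ z : X × Equiv.Perm (Fin m), ((z.1 : G) ∉ N.toSubgroup ∧ z.2 = σ z.1) ↔
        ((z.1 : G) ∉ M.toSubgroup ∧ z.2 = τ z.1)) → N = M := by
    intro N M m σ τ hσ hτ hz
    have hle : Subgroup.closure X ≤ σ.eqLocus τ := by
      rw [Subgroup.closure_le]
      intro x hx
      show σ x = τ x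
      by_cases hxN : x ∈ N.toSubgroup
      · by_cases hxM : x ∈ M.toSubgroup
        · rw [← hσ] at hxN; rw [← hτ] at hxM
          rw [MonoidHom.mem_ker.1 hxN, MonoidHom.mem_ker.1 hxM]
        · exact absurd hxN ((hz (⟨x, hx⟩, τ x)).2 ⟨hxM, rfl⟩).1
      · exact ((hz (⟨x, hx⟩, σ x)).1 ⟨hxN, rfl⟩).2
    -- The locus contains N ⊓ M, hence is open and therefore closed; containing X, it is everything.
    have hopen : IsOpen ((σ.eqLocus τ : Subgroup G) : Set G) := by
      refine Subgroup.isOpen_mono (H₁ := (N ⊓ M).toSubgroup) ?_ (N ⊓ M).isOpen'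
      intro x hx
      have h1 : x ∈ σ.ker := hσ ▸ hx.1
      have h2 : x ∈ τ.ker := hτ ▸ hx.2
      show σ x = τ x
      rw [MonoidHom.mem_ker.1 h1, MonoidHom.mem_ker.1 h2]
    have htop : (⊤ : Subgroup G) ≤ σ.eqLocus τ := by
      rw [← hX]
      exact Subgroup.topologicalClosure_minimal _ hle (Subgroup.isClosed_of_isOpen _ hopen)
    have : σ = τ := MonoidHom.ext fun x => htop (Subgroup.mem_top x)
    apply OpenNormalSubgroup.toSubgroup_injective
    show N.toSubgroup = M.toSubgroup
    rw [← hσ, ← hτ, this]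
  have hF : Function.Injective F := by
    intro N M hNM
    have h1 : n N = n M := congrArg Sigma.fst hNM
    -- The degree m is freed from N so that it can be replaced by the degree of M.
    have aux : ∀ (m : ℕ) (σ : G →* Equiv.Perm (Fin m)) (T : Finset (X × Equiv.Perm (Fin m))),
        σ.ker = N.toSubgroup → (∀ z, z ∈ T ↔ ((z.1 : G) ∉ N.toSubgroup ∧ z.2 = σ z.1)) →
        (⟨m, T⟩ : Σ m : ℕ, Finset (X × Equiv.Perm (Fin m))) = F M → N = M := by
      rintro m σ T hσ hT hm
      obtain rfl : m = n M := congrArg Sigma.fst hm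
      have hT' : T = (hfin M).toFinset := eq_of_heq (Sigma.mk.inj hm).2
      refine main N M _ σ (ρ M) hσ (hρ M) fun z => ?_
      rw [← hT z, hT', Set.Finite.mem_toFinset]
      rfl
    exact aux _ (ρ N) _ (hρ N) (fun z => by rw [Set.Finite.mem_toFinset]; rfl) hNM
  exact hF.countable

end Rank

end Pile

namespace Pile

/-! ### Continuous homomorphisms and quotient maps -/

section Maps

variable {G H K : Type*} [Group G] [TopologicalSpace G] [Group H] [TopologicalSpace H]
  [Group K] [TopologicalSpace K]

/-- The preimage of an open normal subgroup under a continuous homomorphism. -/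
def comapOpenNormal (f : G →ₜ* H) (N : OpenNormalSubgroup H) : OpenNormalSubgroup G where
  toSubgroup := N.toSubgroup.comap f.toMonoidHom
  isOpen' := N.isOpen'.preimage f.continuous_toFun
  isNormal' := Subgroup.normal_comap _

theorem mem_subgrMap [CompactSpace G] [T2Space H] {f : G →ₜ* H} {Γ : ClosedSubgroup G} {y : H} :
    y ∈ (subgrMap f Γ).toSubgroup ↔ ∃ x ∈ Γ.toSubgroup, f x = y := Iff.rfl

theorem closedSubgroup_ext {Γ Δ : ClosedSubgroup G}
    (h : ∀ x, x ∈ Γ.toSubgroup ↔ x ∈ Δ.toSubgroup) : Γ = Δ :=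
  ClosedSubgroup.toSubgroup_injective (Subgroup.ext h)

theorem subgrMap_comp [CompactSpace G] [CompactSpace H] [T2Space H] [T2Space K]
    (g : H →ₜ* K) (f : G →ₜ* H) (Γ : ClosedSubgroup G) :
    subgrMap (g.comp f) Γ = subgrMap g (subgrMap f Γ) := by
  refine closedSubgroup_ext fun x => ?_
  simp only [mem_subgrMap]
  constructor
  · rintro ⟨y, hy, rfl⟩
    exact ⟨f y, ⟨y, hy, rfl⟩, rfl⟩
  · rintro ⟨_, ⟨y, hy, rfl⟩, rfl⟩
    exact ⟨y, hy, rfl⟩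

theorem subgrMap_conjHom [IsTopologicalGroup G] [IsTopologicalGroup H] [CompactSpace G]
    [T2Space G] [CompactSpace H] [T2Space H] (f : G →ₜ* H) (g : G) (Γ : ClosedSubgroup G) :
    subgrMap (conjHom (f g)) (subgrMap f Γ) = subgrMap f (subgrMap (conjHom g) Γ) := by
  rw [← subgrMap_comp, ← subgrMap_comp]
  congr 1
  ext x
  show f g * f x * (f g)⁻¹ = f (g * x * g⁻¹)
  rw [map_mul, map_mul, map_inv]

/-- The projection onto the quotient by an open normal subgroup. -/
def quotientMk (N : OpenNormalSubgroup G) : G →ₜ* G ⧸ N.toSubgroup where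
  toMonoidHom := QuotientGroup.mk' N.toSubgroup
  continuous_toFun := continuous_quotient_mk'

theorem quotientMk_surjective (N : OpenNormalSubgroup G) : Function.Surjective (quotientMk N) :=
  QuotientGroup.mk_surjective

theorem quotientMk_eq_one_iff {N : OpenNormalSubgroup G} {x : G} :
    quotientMk N x = 1 ↔ x ∈ N.toSubgroup := QuotientGroup.eq_one_iff x

/-- The homomorphism induced on quotients by open normal subgroups. -/
def quotientHom [IsTopologicalGroup G] (f : G →ₜ* H) (N : OpenNormalSubgroup G)
    (L : OpenNormalSubgroup H) (h : N ≤ comapOpenNormal f L) :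
    G ⧸ N.toSubgroup →ₜ* H ⧸ L.toSubgroup where
  toMonoidHom := QuotientGroup.map N.toSubgroup L.toSubgroup f.toMonoidHom h
  continuous_toFun := continuous_of_discreteTopology

theorem discreteTopology_closedSubgroup [DiscreteTopology G] :
    DiscreteTopology (ClosedSubgroup G) := by
  refine discreteTopology_iff_isOpen_singleton.2 fun Γ => ?_
  let N : OpenNormalSubgroup G := ⟨⟨⊥, isOpen_discrete _⟩, inferInstance⟩
  convert isOpen_sup_eq N Γ.toSubgroup
  ext Δ
  have : N.toSubgroup = ⊥ := rfl
  rw [Set.mem_singleton_iff, Set.mem_ofPred_eq, this, sup_bot_eq,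
    ClosedSubgroup.toSubgroup_injective.eq_iff]

end Maps

end Pile

namespace GroupPile

open Pile

variable {S : Type v}

/-! ### Epimorphisms of group piles and quotient piles -/

section Epi

variable {G H K : GroupPile.{u} S} {f : G.carrier →ₜ* H.carrier} {g : H.carrier →ₜ* K.carrier}

theorem IsEpi.comp (hg : IsEpi H K g) (hf : IsEpi G H f) : IsEpi G K (g.comp f) := by
  refine ⟨hg.1.comp hf.1, fun i => ?_⟩
  rw [← hg.2 i, ← hf.2 i, Set.image_image]
  exact Set.image_congr fun Γ _ => subgrMap_comp g f Γ

theorem IsEpi.of_comp (hgf : IsEpi G K (g.comp f)) (hf : IsEpi G H f) : IsEpi H K g := by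
  refine ⟨fun y => ?_, fun i => ?_⟩
  · obtain ⟨x, hx⟩ := hgf.1 y
    exact ⟨f x, hx⟩
  · rw [← hgf.2 i, ← hf.2 i, Set.image_image]
    exact Set.image_congr fun Γ _ => (subgrMap_comp g f Γ).symm

theorem IsEpi.isDeficient (hf : IsEpi G H f) (h : G.IsDeficient) : H.IsDeficient := by
  have hbot : ∀ Γ : ClosedSubgroup G.carrier, Γ.toSubgroup = ⊥ → (subgrMap f Γ).toSubgroup = ⊥ := by
    intro Γ hΓ
    show Γ.toSubgroup.map f.toMonoidHom = ⊥
    rw [hΓ, Subgroup.map_bot]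
  show H.subgroups none = _
  rw [← hf.2 none, h]
  ext Δ
  constructor
  · rintro ⟨Γ, hΓ, rfl⟩
    exact hbot Γ hΓ
  · intro hΔ
    obtain ⟨Γ, hΓ⟩ := G.zero_nonempty
    rw [h] at hΓ
    exact ⟨Γ, hΓ, ClosedSubgroup.toSubgroup_injective ((hbot Γ hΓ).trans hΔ.symm)⟩

theorem IsEpi.genSubgroup_le_comap (hf : IsEpi G H f) :
    G.genSubgroup ≤ H.genSubgroup.comap f.toMonoidHom := by
  refine Subgroup.topologicalClosure_minimal _ ?_
    ((Subgroup.isClosed_topologicalClosure _).preimage f.continuous_toFun)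
  refine iSup_le fun p => iSup_le fun Γ => iSup_le fun hΓ => ?_
  rw [← Subgroup.map_le_iff_le_comap]
  refine le_trans ?_ (Subgroup.le_topologicalClosure _)
  have hm : subgrMap f Γ ∈ H.subgroups (some p) := hf.2 (some p) ▸ Set.mem_image_of_mem _ hΓ
  exact le_iSup_of_le p (le_iSup_of_le (subgrMap f Γ) (le_iSup_of_le hm le_rfl))

theorem IsEpi.isEGenerated {e : ℕ} (hf : IsEpi G H f) (h : G.IsEGenerated e) :
    H.IsEGenerated e := by
  refine RankLE.of_surjective h
    (QuotientGroup.map _ _ f.toMonoidHom hf.genSubgroup_le_comap) ?_ ?_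
  · exact (continuous_quotient_mk'.comp f.continuous_toFun).quotient_lift _
  · intro y
    obtain ⟨z, rfl⟩ := QuotientGroup.mk_surjective y
    obtain ⟨x, rfl⟩ := hf.1 z
    exact ⟨QuotientGroup.mk x, rfl⟩

end Epi

/-- The group pile `G / N` for an open normal subgroup `N`. -/
def quotient (G : GroupPile.{u} S) (N : OpenNormalSubgroup G.carrier) : GroupPile.{u} S where
  carrier := ProfiniteGrp.of (G.carrier ⧸ N.toSubgroup)
  subgroups i := subgrMap (quotientMk N) '' G.subgroups i
  isClosed_subgroups i :=
    have := discreteTopology_closedSubgroup (G := G.carrier ⧸ N.toSubgroup)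
    isClosed_discrete _
  conj_mem := by
    rintro i _ ⟨Γ, hΓ, rfl⟩ x
    obtain ⟨g, rfl⟩ := quotientMk_surjective N x
    exact ⟨_, G.conj_mem i Γ hΓ g, (subgrMap_conjHom (quotientMk N) g Γ).symm⟩
  zero_nonempty := G.zero_nonempty.image _
  zero_conj := by
    rintro _ ⟨Γ, hΓ, rfl⟩ _ ⟨Δ, hΔ, rfl⟩
    obtain ⟨g, rfl⟩ := G.zero_conj Γ hΓ Δ hΔ
    exact ⟨quotientMk N g, (subgrMap_conjHom (quotientMk N) g Γ).symm⟩

theorem isEpi_quotientMk (G : GroupPile.{u} S) (N : OpenNormalSubgroup G.carrier) :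
    IsEpi G (G.quotient N) (quotientMk N) :=
  ⟨quotientMk_surjective N, fun _ => rfl⟩

theorem isEpi_quotientHom {G H : GroupPile.{u} S} {f : G.carrier →ₜ* H.carrier}
    (hf : IsEpi G H f) (N : OpenNormalSubgroup G.carrier) (L : OpenNormalSubgroup H.carrier)
    (h : N ≤ comapOpenNormal f L) : IsEpi (G.quotient N) (H.quotient L) (quotientHom f N L h) :=
  IsEpi.of_comp (f := quotientMk N) ((isEpi_quotientMk H L).comp hf) (isEpi_quotientMk G N)

instance finite_quotient (G : GroupPile.{u} S) (N : OpenNormalSubgroup G.carrier) :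
    Finite (G.carrier ⧸ N.toSubgroup) :=
  Subgroup.quotient_finite_of_isOpen _ N.isOpen'

/-! ### Rigid finite quotients of an embedding problem -/

namespace EmbeddingProblem

variable {G : GroupPile.{u} S} (E : EmbeddingProblem G)

/-- The induced map `B / N → A / L` exists and is rigid. -/
def RigidAt (N : OpenNormalSubgroup E.B.carrier) (L : OpenNormalSubgroup E.A.carrier) : Prop :=
  N ≤ comapOpenNormal E.α L ∧
    ∀ p, ∀ Γ ∈ E.B.subgroups (some p), ∀ x ∈ Γ.toSubgroup, E.α x ∈ L.toSubgroup → x ∈ N.toSubgroup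

/-- The embedding problem `(G → A / L, B / N → A / L)`. -/
def quotient (N : OpenNormalSubgroup E.B.carrier) (L : OpenNormalSubgroup E.A.carrier)
    (h : N ≤ comapOpenNormal E.α L) : EmbeddingProblem G where
  A := E.A.quotient L
  B := E.B.quotient N
  φ := (quotientMk L).comp E.φ
  α := quotientHom E.α N L h
  isEpi_φ := (isEpi_quotientMk E.A L).comp E.isEpi_φ
  isEpi_α := isEpi_quotientHom E.isEpi_α N L h

variable {E}

theorem RigidAt.rigid_quotient {N : OpenNormalSubgroup E.B.carrier}
    {L : OpenNormalSubgroup E.A.carrier} (h : E.RigidAt N L) : (E.quotient N L h.1).Rigid := by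
  rintro p _ ⟨Γ, hΓ, rfl⟩ _ ⟨x, hx, rfl⟩ _ ⟨y, hy, rfl⟩ hxy
  have hxy' : quotientMk L (E.α x) = quotientMk L (E.α y) := hxy
  refine QuotientGroup.eq.2 (h.2 p Γ hΓ _ (mul_mem (inv_mem hx) hy) ?_)
  rw [map_mul, map_inv]
  exact QuotientGroup.eq.1 hxy'

/-- Being e-generated and being deficient both pass from B to B/N, so the solvability axiom of
C-piles applies to the finite problem. -/
theorem RigidAt.exists_isEpi {e : ℕ} (hC : G.IsFreeCPile e) (hgen : E.EGenerated e)
    (hdef : E.Deficient) {N : OpenNormalSubgroup E.B.carrier} {L : OpenNormalSubgroup E.A.carrier}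
    (h : E.RigidAt N L) :
    ∃ γ : G.carrier →ₜ* E.B.carrier ⧸ N.toSubgroup, IsEpi G (E.B.quotient N) γ ∧
      ∀ x, quotientHom E.α N L h.1 (γ x) = quotientMk L (E.φ x) :=
  hC.2.2 (E.quotient N L h.1) h.rigid_quotient ((isEpi_quotientMk E.B N).isEGenerated hgen)
    ((isEpi_quotientMk E.B N).isDeficient hdef) (E.B.finite_quotient N)

/-- Around each local subgroup, rigidity of `α` is visible at a finite level. -/
theorem Rigid.exists_openNormal_nhds (hE : E.Rigid) (N : OpenNormalSubgroup E.B.carrier) {p : S}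
    {Γ : ClosedSubgroup E.B.carrier} (hΓ : Γ ∈ E.B.subgroups (some p)) :
    ∃ L : OpenNormalSubgroup E.A.carrier, ∃ t ∈ 𝓝 Γ, ∀ Δ ∈ t, ∀ x ∈ Δ.toSubgroup,
      E.α x ∈ L.toSubgroup → x ∈ N.toSubgroup := by
  -- By injectivity of α on Γ, the compact set α(Γ \ N) misses 1, hence misses some open normal L.
  have hc : IsClosed (E.α '' (Γ.toSubgroup ∩ (N.toSubgroup : Set E.B.carrier)ᶜ)) :=
    ((Γ.isClosed'.inter N.isOpen'.isClosed_compl).isCompact.image E.α.continuous_toFun).isClosed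
  obtain ⟨L, hL⟩ := ProfiniteGrp.exist_openNormalSubgroup_sub_open_nhds_of_one hc.isOpen_compl (by
    rintro ⟨x, ⟨hx, hxN⟩, h1⟩
    refine hxN ?_
    rw [hE p Γ hΓ hx (one_mem Γ.toSubgroup) (h1.trans (map_one E.α).symm)]
    exact one_mem N.toSubgroup)
  -- If Δ agrees with Γ modulo N ∩ α⁻¹(L), then x in Δ differs from some y in Γ by an element of N ∩
  -- α⁻¹(L). So both "α(x) in L" and "x in N" can be tested on y.
  refine ⟨L, _, (hasBasis_nhds_closedSubgroup Γ).mem_of_mem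
    (i := N ⊓ comapOpenNormal E.α L) trivial, fun Δ hΔ x hx hxL => ?_⟩
  have hΔ' : Δ.toSubgroup ⊔ (N ⊓ comapOpenNormal E.α L).toSubgroup =
    Γ.toSubgroup ⊔ (N ⊓ comapOpenNormal E.α L).toSubgroup := hΔ
  have hx' : x ∈ Γ.toSubgroup ⊔ (N ⊓ comapOpenNormal E.α L).toSubgroup :=
    hΔ' ▸ Subgroup.mem_sup_left hx
  obtain ⟨y, hy, z, hz, rfl⟩ := Subgroup.mem_sup_of_normal_right.1 hx'
  have hzL : E.α z ∈ L.toSubgroup := hz.2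
  have hyL : E.α y ∈ L.toSubgroup := by
    rw [map_mul] at hxL
    exact (Subgroup.mul_mem_cancel_right _ hzL).1 hxL
  refine mul_mem ?_ hz.1
  by_contra hyN
  exact hL hyL ⟨y, ⟨hy, hyN⟩, rfl⟩

/-- The local levels L are made uniform by compactness of each set of local subgroups and by
finiteness of S. -/
theorem Rigid.exists_rigidAt [Finite S] (hE : E.Rigid) (N : OpenNormalSubgroup E.B.carrier)
    (L : OpenNormalSubgroup E.A.carrier) :
    ∃ N' ≤ N, ∃ L' ≤ L, E.RigidAt N' L' := by
  have h1 : ∀ p : S, ∃ M : OpenNormalSubgroup E.A.carrier, ∀ Γ ∈ E.B.subgroups (some p),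
      ∀ x ∈ Γ.toSubgroup, E.α x ∈ M.toSubgroup → x ∈ N.toSubgroup := by
    intro p
    refine (E.B.isClosed_subgroups (some p)).isCompact.induction_on
      (p := fun s => ∃ M : OpenNormalSubgroup E.A.carrier, ∀ Γ ∈ s,
        ∀ x ∈ Γ.toSubgroup, E.α x ∈ M.toSubgroup → x ∈ N.toSubgroup) ⟨L, by simp⟩ ?_ ?_ ?_
    · rintro s t hst ⟨M, hM⟩
      exact ⟨M, fun Γ hΓ => hM Γ (hst hΓ)⟩
    · rintro s t ⟨M, hM⟩ ⟨M', hM'⟩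
      refine ⟨M ⊓ M', ?_⟩
      rintro Γ (hΓ | hΓ) x hx hxM
      · exact hM Γ hΓ x hx hxM.1
      · exact hM' Γ hΓ x hx hxM.2
    · intro Γ hΓ
      obtain ⟨M, t, ht, hM⟩ := hE.exists_openNormal_nhds N hΓ
      exact ⟨t, mem_nhdsWithin_of_mem_nhds ht, M, hM⟩
  choose M hM using h1
  have : Fintype S := Fintype.ofFinite S
  have h2 : ∃ M' : OpenNormalSubgroup E.A.carrier, M' ≤ L ∧ ∀ p, M' ≤ M p := by
    suffices ∀ s : Finset S, ∃ M' : OpenNormalSubgroup E.A.carrier, M' ≤ L ∧ ∀ p ∈ s, M' ≤ M p by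
      obtain ⟨M', h, h'⟩ := this Finset.univ
      exact ⟨M', h, fun p => h' p (Finset.mem_univ p)⟩
    intro s
    induction s using Finset.cons_induction with
    | empty => exact ⟨L, le_rfl, by simp⟩
    | cons p s _ ih =>
      obtain ⟨M', h, h'⟩ := ih
      refine ⟨M' ⊓ M p, inf_le_left.trans h, fun q hq => ?_⟩
      rcases Finset.mem_cons.1 hq with rfl | hq
      · exact inf_le_right
      · exact inf_le_left.trans (h' q hq)
  obtain ⟨M', hML, hMp⟩ := h2
  -- Cutting N down to the preimage of M' makes B/N' → A/M' well defined and costs nothing for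
  -- rigidity, which only tests elements already in that preimage.
  refine ⟨N ⊓ comapOpenNormal E.α M', inf_le_left, M', hML, inf_le_right, ?_⟩
  intro p Γ hΓ x hx hxM
  exact ⟨hM p Γ hΓ x hx (hMp p hxM), hxM⟩

end EmbeddingProblem

end GroupPile

namespace Pile

/-! ### Detecting elements and closed subgroups in finite quotients -/

section Separation

variable {G : Type*} [Group G] [TopologicalSpace G] [IsTopologicalGroup G] [CompactSpace G]
  [TotallyDisconnectedSpace G]

theorem eq_of_forall_quotientMk {x y : G}
    (h : ∀ N : OpenNormalSubgroup G, quotientMk N x = quotientMk N y) : x = y := by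
  by_contra hxy
  have hne : x⁻¹ * y ≠ 1 := fun h1 => hxy (inv_mul_eq_one.1 h1)
  obtain ⟨N, hN⟩ := ProfiniteGrp.exist_openNormalSubgroup_sub_open_nhds_of_one
    (isOpen_compl_singleton (x := x⁻¹ * y)) (fun h1 => hne h1.symm)
  exact hN (QuotientGroup.eq.1 (h N) : x⁻¹ * y ∈ N.toSubgroup) rfl

theorem closedSubgroup_le_of_forall_sup {Γ Δ : ClosedSubgroup G}
    (h : ∀ N : OpenNormalSubgroup G, Γ.toSubgroup ≤ Δ.toSubgroup ⊔ N.toSubgroup) :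
    Γ.toSubgroup ≤ Δ.toSubgroup := by
  intro x hx
  by_contra hxΔ
  obtain ⟨N, hN⟩ := ProfiniteGrp.exist_openNormalSubgroup_sub_open_nhds_of_one
    (Δ.isClosed'.isOpen_compl.preimage (continuous_const_mul x))
    (by simpa using hxΔ)
  obtain ⟨d, hd, n, hn, rfl⟩ := Subgroup.mem_sup_of_normal_right.1 (h N hx)
  exact hN (inv_mem hn : n⁻¹ ∈ N.toSubgroup) (by simpa using hd)

theorem closedSubgroup_eq_of_forall_sup {Γ Δ : ClosedSubgroup G}
    (h : ∀ N : OpenNormalSubgroup G,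
      Γ.toSubgroup ⊔ N.toSubgroup = Δ.toSubgroup ⊔ N.toSubgroup) : Γ = Δ :=
  ClosedSubgroup.toSubgroup_injective <| le_antisymm
    (closedSubgroup_le_of_forall_sup fun N => h N ▸ le_sup_left)
    (closedSubgroup_le_of_forall_sup fun N => (h N).symm ▸ le_sup_left)

end Separation

theorem continuous_subgrMap {G H : Type*} [Group G] [TopologicalSpace G] [CompactSpace G]
    [Group H] [TopologicalSpace H] [T2Space H] (f : G →ₜ* H) : Continuous (subgrMap f) := by
  refine continuous_iff_continuousAt.2 fun Γ => ?_
  refine (hasBasis_nhds_closedSubgroup Γ).tendsto_iff (hasBasis_nhds_closedSubgroup _) |>.2 ?_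
  intro N _
  refine ⟨comapOpenNormal f N, trivial, fun Δ hΔ => ?_⟩
  have hΔ' : Δ.toSubgroup ⊔ (comapOpenNormal f N).toSubgroup =
    Γ.toSubgroup ⊔ (comapOpenNormal f N).toSubgroup := hΔ
  have hk : (comapOpenNormal f N).toSubgroup =
      ((QuotientGroup.mk' N.toSubgroup).comp f.toMonoidHom).ker := by
    rw [← MonoidHom.comap_ker, QuotientGroup.ker_mk']
    rfl
  rw [hk, ← Subgroup.map_eq_map_iff, ← Subgroup.map_map, ← Subgroup.map_map] at hΔ'
  exact map_mk_eq_map_mk_iff.1 hΔ'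

theorem subgrMap_quotientMk_eq_iff {G : Type*} [Group G] [TopologicalSpace G]
    [IsTopologicalGroup G] [CompactSpace G] {N : OpenNormalSubgroup G} {Γ Δ : ClosedSubgroup G} :
    subgrMap (quotientMk N) Γ = subgrMap (quotientMk N) Δ ↔
      Γ.toSubgroup ⊔ N.toSubgroup = Δ.toSubgroup ⊔ N.toSubgroup := by
  rw [← ClosedSubgroup.toSubgroup_injective.eq_iff]
  exact map_mk_eq_map_mk_iff

end Pile

namespace GroupPile

open Pile

variable {S : Type v}

/-- Between deficient piles the condition at 0 holds for free. This matters because the colanguage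
has no symbol for 𝒢₀. -/
theorem isEpi_of_isDeficient {G H : GroupPile.{u} S} {f : G.carrier →ₜ* H.carrier}
    (hG : G.IsDeficient) (hH : H.IsDeficient) (hf : Function.Surjective f)
    (h : ∀ p, subgrMap f '' G.subgroups (some p) = H.subgroups (some p)) : IsEpi G H f := by
  refine ⟨hf, fun i => ?_⟩
  cases i with
  | some p => exact h p
  | none =>
    have hbot : ∀ Γ ∈ G.subgroups none, (subgrMap f Γ).toSubgroup = ⊥ := by
      intro Γ hΓ
      rw [hG] at hΓ
      have hΓ' : Γ.toSubgroup = ⊥ := hΓ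
      show Γ.toSubgroup.map f.toMonoidHom = ⊥
      rw [hΓ', Subgroup.map_bot]
    ext Δ
    rw [hH]
    constructor
    · rintro ⟨Γ, hΓ, rfl⟩
      exact hbot Γ hΓ
    · intro hΔ
      obtain ⟨Γ, hΓ⟩ := G.zero_nonempty
      exact ⟨Γ, hΓ, ClosedSubgroup.toSubgroup_injective ((hbot Γ hΓ).trans hΔ.symm)⟩

/-! ### Epimorphisms onto finite groups as tuples in S(G) -/

section Fiber

variable {G : GroupPile.{u} S} {F : Type u} [Group F] [TopologicalSpace F] [DiscreteTopology F]

/-- The kernel of a homomorphism to a discrete group. -/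
def kerOpenNormal (f : G.carrier →ₜ* F) : OpenNormalSubgroup G.carrier :=
  comapOpenNormal f ⟨⟨⊥, isOpen_discrete _⟩, inferInstance⟩

theorem toSubgroup_kerOpenNormal (f : G.carrier →ₜ* F) :
    (kerOpenNormal f).toSubgroup = f.toMonoidHom.ker := rfl

/-- The fiber of `f` over `b`, as an element of `S(G)`. -/
noncomputable def fiber (f : G.carrier →ₜ* F) (b : F) : G.CoSys :=
  ⟨kerOpenNormal f, QuotientGroup.mk (Function.invFun f b)⟩

theorem fiber_apply (f : G.carrier →ₜ* F) (g : G.carrier) :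
    fiber f (f g) = ⟨kerOpenNormal f, QuotientGroup.mk g⟩ := by
  have h : f (Function.invFun f (f g)) = f g := Function.invFun_eq ⟨g, rfl⟩
  refine Sigma.ext rfl (heq_of_eq (QuotientGroup.eq.2 ?_))
  rw [toSubgroup_kerOpenNormal, MonoidHom.mem_ker]
  show f _ = 1
  rw [map_mul, map_inv, h, inv_mul_cancel]

theorem fiber_apply_eq (f : G.carrier →ₜ* F) (g : G.carrier) {N : OpenNormalSubgroup G.carrier}
    (hN : kerOpenNormal f = N) : fiber f (f g) = ⟨N, QuotientGroup.mk g⟩ := by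
  subst hN
  exact fiber_apply f g

theorem coset_fiber {f : G.carrier →ₜ* F} (hf : Function.Surjective f) (b : F) :
    (fiber f b).coset = {g | f g = b} := by
  obtain ⟨x, rfl⟩ := hf b
  rw [fiber_apply]
  ext g
  show (QuotientGroup.mk g : G.carrier ⧸ (kerOpenNormal f).toSubgroup) = QuotientGroup.mk x ↔
    f g = f x
  rw [QuotientGroup.eq, toSubgroup_kerOpenNormal, MonoidHom.mem_ker]
  show f _ = 1 ↔ _
  rw [map_mul, map_inv, inv_mul_eq_one]

theorem fiber_injective {f : G.carrier →ₜ* F} (hf : Function.Surjective f) :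
    Function.Injective (fiber f) := by
  intro b c h
  obtain ⟨g, hg⟩ := hf b
  have hg' : g ∈ (fiber f b).coset := by rw [coset_fiber hf]; exact hg
  rw [h, coset_fiber hf] at hg'
  exact hg.symm.trans hg'

theorem index_fiber {f : G.carrier →ₜ* F} (hf : Function.Surjective f) (b : F) :
    (fiber f b).1.toSubgroup.index = Nat.card F := by
  show (f.toMonoidHom.ker).index = _
  rw [Subgroup.index_ker, MonoidHom.range_eq_top.2 hf]
  exact Nat.card_congr Subgroup.topEquiv.toEquiv

theorem coRelMap_prod_fiber {f : G.carrier →ₜ* F} (hf : Function.Surjective f) (b c : F) :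
    G.coRelMap CoRel.prod ![fiber f b, fiber f c, fiber f (b * c)] := by
  obtain ⟨x, rfl⟩ := hf b
  obtain ⟨y, rfl⟩ := hf c
  rw [← map_mul, fiber_apply, fiber_apply, fiber_apply]
  exact ⟨_, _, _, rfl, rfl, rfl⟩

/-- The injection G/ker f → F induced by f carries the image of Γ in G/ker f to f(Γ), and the fibers
to the points `y j`. -/
theorem coRelMap_loc_fiber {f : G.carrier →ₜ* F} (hf : Function.Surjective f) (p : S) {n : ℕ}
    [NeZero n] (hn : Nat.card F ≤ n) (y : Fin n → F) :
    G.coRelMap (CoRel.loc p n) (fun j => fiber f (y j)) ↔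
      ∃ Γ ∈ G.subgroups (some p), f '' (Γ : Set G.carrier) = Set.range y := by
  obtain ⟨l, hinj, hl⟩ : ∃ l : (G.carrier ⧸ (kerOpenNormal f).toSubgroup) → F,
      Function.Injective l ∧ ∀ g : G.carrier, l (QuotientGroup.mk g) = f g :=
    ⟨QuotientGroup.kerLift f.toMonoidHom, QuotientGroup.kerLift_injective _, fun _ => rfl⟩
  have himage : ∀ s : Set G.carrier, f '' s = l '' (QuotientGroup.mk '' s) := fun s => by
    simp only [Set.image_image, hl]
  have hy : ∀ j, l (fiber f (y j)).2 = y j := fun j =>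
    (hl _).trans (Function.invFun_eq (hf (y j)))
  have hrange : ∀ z : Fin n → G.carrier ⧸ (kerOpenNormal f).toSubgroup,
      (∀ j, z j = (fiber f (y j)).2) →
      Set.range y = l '' Set.range z := by
    intro z hz
    rw [← Set.range_comp]
    congr 1
    funext j
    rw [Function.comp_apply, hz]
    exact (hy j).symm
  constructor
  · rintro ⟨N, -, z, hz, Γ, hΓ, h⟩
    -- An empty tuple would not determine N; this is where n ≠ 0 is needed.
    obtain rfl : kerOpenNormal f = N := congrArg Sigma.fst (hz 0)
    refine ⟨Γ, hΓ, ?_⟩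
    rw [himage, h, hrange z fun j => (eq_of_heq (Sigma.mk.inj (hz j)).2).symm]
  · rintro ⟨Γ, hΓ, h⟩
    refine ⟨kerOpenNormal f, (index_fiber hf (y 0)).trans_le hn, fun j => (fiber f (y j)).2,
      fun j => rfl, Γ, hΓ, ?_⟩
    rw [himage, hrange _ fun j => rfl] at h
    exact hinj.image_injective h

/-- A family of elements of `S(G)` that satisfies the multiplication table of a finite group `F`
consists of the fibers of an epimorphism onto `F`. -/
theorem exists_eq_fiber [Finite F] {x : F → G.CoSys}
    (hidx : ∀ b, (x b).1.toSubgroup.index ≤ Nat.card F) (hinj : Function.Injective x)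
    (hprod : ∀ b c, G.coRelMap CoRel.prod ![x b, x c, x (b * c)]) :
    ∃ f : G.carrier →ₜ* F, Function.Surjective f ∧ ∀ b, x b = fiber f b := by
  obtain ⟨N, hN⟩ : ∃ N : OpenNormalSubgroup G.carrier, ∀ b,
      ∃ c : G.carrier ⧸ N.toSubgroup, x b = ⟨N, c⟩ := by
    refine ⟨(x 1).1, fun b => ?_⟩
    obtain ⟨M, a, a', h1, h2, -⟩ := hprod 1 b
    have h1' : x 1 = ⟨M, a⟩ := h1
    rw [h1']
    exact ⟨a', h2⟩
  choose c hc using hN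
  have hmul : ∀ b b', c (b * b') = c b * c b' := by
    intro b b'
    obtain ⟨M, a, a', h1, h2, h3⟩ := hprod b b'
    have h1' := (hc b).symm.trans h1
    have h2' := (hc b').symm.trans h2
    have h3' := (hc (b * b')).symm.trans h3
    obtain rfl : N = M := congrArg Sigma.fst h1'
    rw [eq_of_heq (Sigma.mk.inj h1').2, eq_of_heq (Sigma.mk.inj h2').2,
      eq_of_heq (Sigma.mk.inj h3').2]
  have hcinj : Function.Injective c := fun b b' h => hinj (by rw [hc, hc, h])
  -- The index bound is what makes the injective homomorphism c onto.
  have hcard : Nat.card (G.carrier ⧸ N.toSubgroup) ≤ Nat.card F := by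
    have h := hidx 1
    rw [hc] at h
    exact h
  have hbij : Function.Bijective c := hcinj.bijective_of_nat_card_le hcard
  let e : F ≃* G.carrier ⧸ N.toSubgroup := MulEquiv.ofBijective (MonoidHom.mk' c hmul) hbij
  let f : G.carrier →ₜ* F :=
    { toMonoidHom := e.symm.toMonoidHom.comp (QuotientGroup.mk' N.toSubgroup)
      continuous_toFun := (continuous_of_discreteTopology (f := e.symm)).comp
        continuous_quotient_mk' }
  have hker : kerOpenNormal f = N := by
    apply OpenNormalSubgroup.toSubgroup_injective
    show (e.symm.toMonoidHom.comp (QuotientGroup.mk' N.toSubgroup)).ker = N.toSubgroup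
    rw [MonoidHom.ker_comp_of_injective _ _ e.symm.injective, QuotientGroup.ker_mk']
  have hf : ∀ g, f g = e.symm (QuotientGroup.mk g) := fun g => rfl
  refine ⟨f, e.symm.surjective.comp QuotientGroup.mk_surjective, fun b => ?_⟩
  obtain ⟨g, hg⟩ := QuotientGroup.mk_surjective (c b)
  have hb : f g = b := by
    rw [hf, hg]
    exact e.symm_apply_apply b
  rw [hc, ← hg]
  conv_rhs => rw [← hb]
  exact (fiber_apply_eq f g hker).symm

end Fiber

end GroupPile

namespace GroupPile

open Pile FirstOrder Language

variable {S : Type v}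

/-! ### The directed set of rigid pairs and systems of solutions -/

namespace EmbeddingProblem

variable {G : GroupPile.{u} S} (E : EmbeddingProblem G)

/-- The pairs `(N, L)` for which `B / N → A / L` is a rigid epimorphism. -/
def RigidPair : Type u :=
  {q : OpenNormalSubgroup E.B.carrier × OpenNormalSubgroup E.A.carrier // E.RigidAt q.1 q.2}

instance : PartialOrder E.RigidPair := inferInstanceAs (PartialOrder (Subtype _))

variable {E}

/-- The quotient `B / N` attached to the pair `(N, L)`. -/
abbrev RigidPair.Quot (i : E.RigidPair) : Type u := E.B.carrier ⧸ i.1.1.toSubgroup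

/-- The epimorphism `B / N → A / L`. -/
def RigidPair.hom (i : E.RigidPair) : i.Quot →ₜ* E.A.carrier ⧸ i.1.2.toSubgroup :=
  quotientHom E.α i.1.1 i.1.2 i.2.1

/-- The transition map `B / N → B / N'` for `N ≤ N'`. -/
def RigidPair.trans {i j : E.RigidPair} (h : i ≤ j) : i.Quot →ₜ* j.Quot :=
  quotientHom (ContinuousMonoidHom.id E.B.carrier) i.1.1 j.1.1 h.1

theorem RigidPair.trans_mk {i j : E.RigidPair} (h : i ≤ j) (x : E.B.carrier) :
    RigidPair.trans h (quotientMk i.1.1 x) = quotientMk j.1.1 x := rfl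

theorem RigidPair.hom_mk (i : E.RigidPair) (x : E.B.carrier) :
    i.hom (quotientMk i.1.1 x) = quotientMk i.1.2 (E.α x) := rfl

/-- A compatible system of solutions of the finite embedding problems indexed by `s`. -/
structure IsSystem (s : Set E.RigidPair) (f : ∀ i : E.RigidPair, G.carrier →ₜ* i.Quot) : Prop where
  isEpi : ∀ i ∈ s, IsEpi G (E.B.quotient i.1.1) (f i)
  solves : ∀ i ∈ s, ∀ x, i.hom (f i x) = quotientMk i.1.2 (E.φ x)
  compatible : ∀ i ∈ s, ∀ j ∈ s, ∀ h : i ≤ j, ∀ x, RigidPair.trans h (f i x) = f j x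

theorem Rigid.exists_rigidPair_le [Finite S] (hE : E.Rigid) (N : OpenNormalSubgroup E.B.carrier)
    (L : OpenNormalSubgroup E.A.carrier) : ∃ i : E.RigidPair, i.1.1 ≤ N ∧ i.1.2 ≤ L := by
  obtain ⟨N', hN, L', hL, h⟩ := hE.exists_rigidAt N L
  exact ⟨⟨(N', L'), h⟩, hN, hL⟩

theorem Rigid.exists_rigidPair_le_le [Finite S] (hE : E.Rigid) (i j : E.RigidPair) :
    ∃ k : E.RigidPair, k ≤ i ∧ k ≤ j := by
  obtain ⟨k, hN, hL⟩ := hE.exists_rigidPair_le (i.1.1 ⊓ j.1.1) (i.1.2 ⊓ j.1.2)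
  exact ⟨k, ⟨hN.trans inf_le_left, hL.trans inf_le_left⟩,
    ⟨hN.trans inf_le_right, hL.trans inf_le_right⟩⟩

/-- A solution at k, composed with the transition maps, solves every problem above k, and the
resulting family is compatible by construction. -/
theorem exists_isSystem_Ici {e : ℕ} (hC : G.IsFreeCPile e) (hgen : E.EGenerated e)
    (hdef : E.Deficient) (k : E.RigidPair) :
    ∃ f : ∀ i : E.RigidPair, G.carrier →ₜ* i.Quot, IsSystem (Set.Ici k) f := by
  classical
  obtain ⟨γ, hγ, hc⟩ := k.2.exists_isEpi hC hgen hdef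
  let f : ∀ i : E.RigidPair, G.carrier →ₜ* i.Quot := fun i =>
    if h : k ≤ i then (RigidPair.trans h).comp γ else ⟨1, continuous_const⟩
  have hf : ∀ i (h : k ≤ i) x, f i x = RigidPair.trans h (γ x) := by
    intro i h x
    simp only [f, dif_pos h]
    rfl
  refine ⟨f, ?_, ?_, ?_⟩
  · intro i (hi : k ≤ i)
    have : f i = (RigidPair.trans hi).comp γ := dif_pos hi
    rw [this]
    refine IsEpi.comp (H := E.B.quotient k.1.1) ?_ hγ
    exact isEpi_quotientHom (G := E.B) (H := E.B) (f := ContinuousMonoidHom.id _)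
      ⟨Function.surjective_id, fun p => (Set.image_congr fun Γ _ =>
        closedSubgroup_ext fun x => by simp [mem_subgrMap]).trans (Set.image_id _)⟩ _ _ hi.1
  · intro i (hi : k ≤ i) x
    rw [hf i hi]
    obtain ⟨b, hb⟩ := quotientMk_surjective _ (γ x)
    have h1 : quotientMk k.1.2 (E.α b) = quotientMk k.1.2 (E.φ x) := by
      rw [← hc x, ← hb]
      rfl
    rw [← hb, RigidPair.trans_mk, RigidPair.hom_mk]
    exact QuotientGroup.eq.2 (hi.2 (QuotientGroup.eq.1 h1))
  · intro i (hi : k ≤ i) j (hj : k ≤ j) h x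
    rw [hf i hi, hf j hj]
    obtain ⟨b, hb⟩ := quotientMk_surjective _ (γ x)
    rw [← hb]
    rfl

end EmbeddingProblem

/-! ### From partial systems to a full system by cosaturation -/

section Cosaturation

variable {G : GroupPile.{u} S} {E : EmbeddingProblem G}

open EmbeddingProblem

theorem realize_rel_iff {α : Type*} {n : ℕ} (R : CoRel S n) (t : Fin n → α) (x : α → G.CoSys) :
    (Relations.formula (L := coLang S) R fun j => Term.var (t j)).Realize x ↔
      G.coRelMap R fun j => x (t j) :=
  Formula.realize_rel

theorem isCoformula_rel {β : Type*} {n : ℕ} (R : CoRel S n) (t : Fin n → β) :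
    IsCoformula (Relations.formula (L := coLang S) R fun j => Term.var (t j)) :=
  IsCoformula.rel _ _

/-- The relations 𝒢_{p,n} list a subgroup by a tuple of fixed length n, repetitions allowed; shorter
lists are padded with a chosen element. -/
theorem exists_range_eq {F : Type*} [Finite F] {s : Set F} (hs : s.Nonempty) :
    ∃ y : Fin (Nat.card F) → F, s = Set.range y := by
  classical
  obtain ⟨a, ha⟩ := hs
  let e := Finite.equivFin F
  refine ⟨fun j => if e.symm j ∈ s then e.symm j else a, ?_⟩
  ext b
  constructor
  · intro hb
    exact ⟨e b, by simp [hb]⟩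
  · rintro ⟨j, rfl⟩
    dsimp only
    split_ifs with hj
    · exact hj
    · exact ha

/-- One variable for each element b of each quotient B/N stands for the fiber over b of the unknown
epimorphism G → B/N. The axioms of a system become countably many coformulas, finitely satisfiable
by the systems above a single pair. -/
theorem exists_isSystem_univ [Finite S] (hrigid : E.Rigid)
    (hrank : RankLE E.B.carrier Cardinal.aleph0)
    (hsat : G.IsCosaturated (Cardinal.aleph 1 : Cardinal.{0})) (hG : G.IsDeficient)
    (hdef : E.Deficient)
    (h : ∀ k : E.RigidPair, ∃ f : ∀ i : E.RigidPair, G.carrier →ₜ* i.Quot,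
      IsSystem (Set.Ici k) f) :
    ∃ f : ∀ i : E.RigidPair, G.carrier →ₜ* i.Quot, IsSystem Set.univ f := by
  have hB : Countable (OpenNormalSubgroup E.B.carrier) := hrank.countable_openNormalSubgroup
  -- Taking preimages along the surjection α is injective, so countability passes from B to A.
  have hA : Countable (OpenNormalSubgroup E.A.carrier) := by
    refine Function.Injective.countable (f := comapOpenNormal E.α) fun L L' hL => ?_
    apply OpenNormalSubgroup.toSubgroup_injective
    refine Subgroup.comap_injective (f := E.α.toMonoidHom) E.isEpi_α.1 ?_
    exact congrArg (fun N : OpenNormalSubgroup E.B.carrier => N.toSubgroup) hL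
  have hI : Countable E.RigidPair := inferInstanceAs (Countable (Subtype _))
  have hX : Countable (Σ i : E.RigidPair, i.Quot) := inferInstance
  -- Cosaturation for a cardinal in universe 0 takes its variables from `Type`; a countable index
  -- type can be shrunk there.
  let V : Type := Shrink.{0} (Σ i : E.RigidPair, i.Quot)
  let enc : (Σ i : E.RigidPair, i.Quot) ≃ V := equivShrink _
  let asg : (∀ i : E.RigidPair, G.carrier →ₜ* i.Quot) → V → G.CoSys :=
    fun f v => fiber (f (enc.symm v).1) (enc.symm v).2
  have hasg : ∀ f z, asg f (enc z) = fiber (f z.1) z.2 := fun f z =>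
    congrArg (fun w : Σ i : E.RigidPair, i.Quot => (fiber (f w.1) w.2 : G.CoSys))
      (enc.symm_apply_apply z)
  let var : (Σ i : E.RigidPair, i.Quot) → G.CoSys ⊕ V := fun z => Sum.inr (enc z)
  let par : ∀ i : E.RigidPair, E.A.carrier ⧸ i.1.2.toSubgroup → G.CoSys ⊕ V :=
    fun i a => Sum.inl (fiber ((quotientMk i.1.2).comp E.φ) a)
  let fIdx : (Σ i : E.RigidPair, i.Quot) → (coLang S).Formula (G.CoSys ⊕ V) :=
    fun z => idxFormula (Nat.card z.1.Quot) (var z)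
  let fNe : (Σ i : E.RigidPair, i.Quot × i.Quot) → (coLang S).Formula (G.CoSys ⊕ V) :=
    fun z => ((Term.var (var ⟨z.1, z.2.1⟩) : (coLang S).Term _).equal
      (Term.var (var ⟨z.1, z.2.2⟩))).not
  let tProd : (Σ i : E.RigidPair, i.Quot × i.Quot) → Fin 3 → G.CoSys ⊕ V := fun z =>
    ![var ⟨z.1, z.2.1⟩, var ⟨z.1, z.2.2⟩, var ⟨z.1, z.2.1 * z.2.2⟩]
  let fProd : (Σ i : E.RigidPair, i.Quot × i.Quot) → (coLang S).Formula (G.CoSys ⊕ V) :=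
    fun z => Relations.formula (L := coLang S) CoRel.prod fun j => Term.var (tProd z j)
  let fSub : (Σ i : E.RigidPair, i.Quot) × (Σ i : E.RigidPair, i.Quot) →
      (coLang S).Formula (G.CoSys ⊕ V) :=
    fun z => Relations.formula (L := coLang S) CoRel.sub fun j => Term.var (![var z.1, var z.2] j)
  let fPar : (Σ i : E.RigidPair, i.Quot) → (coLang S).Formula (G.CoSys ⊕ V) :=
    fun z => Relations.formula (L := coLang S) CoRel.sub fun j =>
      Term.var (![var z, par z.1 (z.1.hom z.2)] j)
  let fLoc : (S × Σ i : E.RigidPair, (Fin (Nat.card i.Quot) → i.Quot)) →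
      (coLang S).Formula (G.CoSys ⊕ V) :=
    fun z => Relations.formula (L := coLang S) (CoRel.loc z.1 (Nat.card z.2.1.Quot))
      fun j => Term.var (var ⟨z.2.1, z.2.2 j⟩)
  -- Candidates only, not all of them true in a system. Membership in 𝒢_{p,n} occurs with both
  -- signs, since the image of 𝒢_p must be neither too small nor too large.
  let C : Set ((coLang S).Formula (G.CoSys ⊕ V)) :=
    Set.range fIdx ∪ (Set.range fNe ∪ (Set.range fProd ∪ (Set.range fSub ∪
      (Set.range fPar ∪ (Set.range fLoc ∪ Set.range fun z => (fLoc z).not)))))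
  have hCc : C.Countable :=
    (Set.countable_range _).union <| (Set.countable_range _).union <|
    (Set.countable_range _).union <| (Set.countable_range _).union <|
    (Set.countable_range _).union <| (Set.countable_range _).union <| Set.countable_range _
  have hCo : ∀ φ ∈ C, IsCoformula φ := by
    rintro φ (⟨z, rfl⟩ | ⟨z, rfl⟩ | ⟨z, rfl⟩ | ⟨z, rfl⟩ | ⟨z, rfl⟩ | ⟨z, rfl⟩ | ⟨z, rfl⟩)
    · exact IsCoformula.rel _ _
    · exact (IsCoformula.equal _ _).imp (IsCoformula.falsum _)
    · exact isCoformula_rel _ _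
    · exact isCoformula_rel _ _
    · exact isCoformula_rel _ _
    · exact isCoformula_rel _ _
    · exact (isCoformula_rel _ _).imp (IsCoformula.falsum _)
  -- Keeping the candidates that hold in every system on every sufficiently deep cone makes finite
  -- satisfiability a matter of directedness; the axioms of a system are then shown to lie in Φ.
  let Φ : Set ((coLang S).Formula (G.CoSys ⊕ V)) :=
    {φ | φ ∈ C ∧ ∃ k : E.RigidPair, ∀ k' ≤ k, ∀ f, IsSystem (Set.Ici k') f →
      φ.Realize (Sum.elim id (asg f))}
  have rIdx : ∀ z (x : V → G.CoSys), (fIdx z).Realize (Sum.elim id x) ↔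
      (x (enc z)).1.toSubgroup.index ≤ Nat.card z.1.Quot := fun z x =>
    Formula.realize_rel₁
  have rNe : ∀ z (x : V → G.CoSys), (fNe z).Realize (Sum.elim id x) ↔
      x (enc ⟨z.1, z.2.1⟩) ≠ x (enc ⟨z.1, z.2.2⟩) := fun z x => by
    rw [Formula.realize_not, Formula.realize_equal]
    rfl
  have rProd : ∀ z (x : V → G.CoSys), (fProd z).Realize (Sum.elim id x) ↔
      G.coRelMap CoRel.prod ![x (enc ⟨z.1, z.2.1⟩), x (enc ⟨z.1, z.2.2⟩),
        x (enc ⟨z.1, z.2.1 * z.2.2⟩)] := fun z x => by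
    refine (realize_rel_iff _ _ _).trans (iff_of_eq (congrArg _ ?_))
    funext j
    fin_cases j <;> rfl
  have rSub : ∀ z (x : V → G.CoSys), (fSub z).Realize (Sum.elim id x) ↔
      (x (enc z.1)).coset ⊆ (x (enc z.2)).coset := fun z x =>
    realize_rel_iff _ _ _
  have rPar : ∀ z (x : V → G.CoSys), (fPar z).Realize (Sum.elim id x) ↔
      (x (enc z)).coset ⊆
        (fiber ((quotientMk z.1.1.2).comp E.φ) (z.1.hom z.2) : G.CoSys).coset := fun z x =>
    realize_rel_iff _ _ _
  have rLoc : ∀ z (x : V → G.CoSys), (fLoc z).Realize (Sum.elim id x) ↔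
      G.coRelMap (CoRel.loc z.1 (Nat.card z.2.1.Quot)) (fun j => x (enc ⟨z.2.1, z.2.2 j⟩)) :=
    fun z x => realize_rel_iff _ _ _
  have hsurjA : ∀ i : E.RigidPair, Function.Surjective ((quotientMk i.1.2).comp E.φ) := fun i =>
    (quotientMk_surjective _).comp E.isEpi_φ.1
  have hsurj : ∀ {s : Set E.RigidPair} {f : ∀ i : E.RigidPair, G.carrier →ₜ* i.Quot},
      IsSystem s f → ∀ i ∈ s, Function.Surjective (f i) := fun hf i hi => (hf.isEpi i hi).1
  have hne : ∀ i : E.RigidPair, NeZero (Nat.card i.Quot) := fun i => ⟨Nat.card_pos.ne'⟩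
  have mIdx : ∀ z, fIdx z ∈ Φ := by
    refine fun z => ⟨Or.inl ⟨z, rfl⟩, z.1, fun k' hk f hf => (rIdx _ _).2 ?_⟩
    rw [hasg]
    exact (index_fiber (hsurj hf _ hk) _).le
  have mNe : ∀ z, z.2.1 ≠ z.2.2 → fNe z ∈ Φ := by
    refine fun z hz => ⟨Or.inr (Or.inl ⟨z, rfl⟩), z.1, fun k' hk f hf => (rNe _ _).2 ?_⟩
    rw [hasg, hasg]
    exact (fiber_injective (hsurj hf _ hk)).ne hz
  have mProd : ∀ z, fProd z ∈ Φ := by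
    refine fun z => ⟨Or.inr (Or.inr (Or.inl ⟨z, rfl⟩)), z.1, fun k' hk f hf => (rProd _ _).2 ?_⟩
    rw [hasg, hasg, hasg]
    exact coRelMap_prod_fiber (hsurj hf _ hk) _ _
  have mSub : ∀ (i j : E.RigidPair) (hij : i ≤ j) (b : i.Quot),
      fSub (⟨i, b⟩, ⟨j, RigidPair.trans hij b⟩) ∈ Φ := by
    refine fun i j hij b => ⟨Or.inr (Or.inr (Or.inr (Or.inl ⟨_, rfl⟩))), i,
      fun k' hk f hf => (rSub _ _).2 ?_⟩
    rw [hasg, hasg, coset_fiber (hsurj hf _ hk), coset_fiber (hsurj hf _ (le_trans hk hij))]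
    rintro x rfl
    exact (hf.compatible _ hk _ (le_trans hk hij) hij x).symm
  have mPar : ∀ z, fPar z ∈ Φ := by
    refine fun z => ⟨Or.inr (Or.inr (Or.inr (Or.inr (Or.inl ⟨z, rfl⟩)))), z.1,
      fun k' hk f hf => (rPar _ _).2 ?_⟩
    rw [hasg, coset_fiber (hsurj hf _ hk), coset_fiber (hsurjA z.1)]
    intro x hx
    have hx' : f z.1 x = z.2 := hx
    show quotientMk z.1.1.2 (E.φ x) = z.1.hom z.2
    rw [← hx']
    exact (hf.solves _ hk x).symm
  have hloc : ∀ {f : ∀ i : E.RigidPair, G.carrier →ₜ* i.Quot} (p : S) (i : E.RigidPair)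
      (y : Fin (Nat.card i.Quot) → i.Quot), Function.Surjective (f i) →
      ((fLoc (p, ⟨i, y⟩)).Realize (Sum.elim id (asg f)) ↔
        ∃ Γ ∈ G.subgroups (some p), f i '' (Γ : Set G.carrier) = Set.range y) := by
    intro f p i y hf
    rw [rLoc]
    simp only [hasg]
    exact coRelMap_loc_fiber hf p le_rfl y
  have hepi : ∀ {f : ∀ i : E.RigidPair, G.carrier →ₜ* i.Quot} (p : S) (i : E.RigidPair)
      (y : Fin (Nat.card i.Quot) → i.Quot), IsEpi G (E.B.quotient i.1.1) (f i) →
      ((fLoc (p, ⟨i, y⟩)).Realize (Sum.elim id (asg f)) ↔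
        ∃ Δ ∈ (E.B.quotient i.1.1).subgroups (some p), ((Δ : Set (E.B.quotient i.1.1).carrier) : Set i.Quot) = Set.range y) := by
    intro f p i y hf
    rw [hloc p i y hf.1, ← hf.2 (some p)]
    constructor
    · rintro ⟨Γ, hΓ, h⟩
      exact ⟨_, ⟨Γ, hΓ, rfl⟩, h⟩
    · rintro ⟨_, ⟨Γ, hΓ, rfl⟩, h⟩
      exact ⟨Γ, hΓ, h⟩
  have mLoc : ∀ (p : S) (i : E.RigidPair) (y : Fin (Nat.card i.Quot) → i.Quot),
      (∃ Δ ∈ (E.B.quotient i.1.1).subgroups (some p), ((Δ : Set (E.B.quotient i.1.1).carrier) : Set i.Quot) = Set.range y) →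
      fLoc (p, ⟨i, y⟩) ∈ Φ := fun p i y hy =>
    ⟨Or.inr (Or.inr (Or.inr (Or.inr (Or.inr (Or.inl ⟨_, rfl⟩))))), i,
      fun k' hk f hf => (hepi p i y (hf.isEpi i hk)).2 hy⟩
  have mLocNot : ∀ (p : S) (i : E.RigidPair) (y : Fin (Nat.card i.Quot) → i.Quot),
      (¬ ∃ Δ ∈ (E.B.quotient i.1.1).subgroups (some p), ((Δ : Set (E.B.quotient i.1.1).carrier) : Set i.Quot) = Set.range y) →
      (fLoc (p, ⟨i, y⟩)).not ∈ Φ := fun p i y hy =>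
    ⟨Or.inr (Or.inr (Or.inr (Or.inr (Or.inr (Or.inr ⟨_, rfl⟩))))), i,
      fun k' hk f hf => Formula.realize_not.2 fun hr => hy ((hepi p i y (hf.isEpi i hk)).1 hr)⟩
  obtain ⟨x, hx⟩ : G.Cosatisfies Φ := by
    refine hsat V Φ (fun φ hφ => hCo φ hφ.1) ?_ ?_ ?_
    · intro φ _ v _
      obtain ⟨z, rfl⟩ := enc.surjective v
      exact ⟨_, mIdx z⟩
    · have h1 : Cardinal.mk Φ ≤ Cardinal.aleph0 :=
        Cardinal.le_aleph0_iff_set_countable.2 (hCc.mono fun φ hφ => hφ.1)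
      refine h1.trans_lt ?_
      have h2 : Cardinal.lift.{max u v} Cardinal.aleph0.{0} = Cardinal.aleph0.{max u v} :=
        Cardinal.lift_aleph0.{max u v, 0}
      rw [← h2, Cardinal.lift_lt]
      exact Cardinal.aleph0_lt_aleph_one
    · intro Φ₀ hΦ hfin
      have hk : ∃ k : E.RigidPair, ∀ φ ∈ Φ₀, ∀ f, IsSystem (Set.Ici k) f →
          φ.Realize (Sum.elim id (asg f)) := by
        -- The induction needs the statement for all k' ≤ k, so that k can be lowered when a formula
        -- is added.
        have : ∃ k : E.RigidPair, ∀ φ ∈ Φ₀, ∀ k' ≤ k, ∀ f, IsSystem (Set.Ici k') f →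
            φ.Realize (Sum.elim id (asg f)) := by
          induction Φ₀, hfin using Set.Finite.induction_on with
          | empty =>
            obtain ⟨k, -⟩ := hrigid.exists_rigidPair_le ⟨⟨⊤, isOpen_univ⟩, inferInstance⟩
              ⟨⟨⊤, isOpen_univ⟩, inferInstance⟩
            exact ⟨k, by simp⟩
          | insert _ _ ih =>
            obtain ⟨hφ, hs⟩ := Set.insert_subset_iff.1 hΦ
            obtain ⟨k₁, h₁⟩ := ih hs
            obtain ⟨-, k₂, h₂⟩ := hφ
            obtain ⟨k, hk₁, hk₂⟩ := hrigid.exists_rigidPair_le_le k₁ k₂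
            refine ⟨k, ?_⟩
            rintro ψ (rfl | hψ) k' hk'
            · exact h₂ k' (hk'.trans hk₂)
            · exact h₁ ψ hψ k' (hk'.trans hk₁)
        obtain ⟨k, hk⟩ := this
        exact ⟨k, fun φ hφ => hk φ hφ k le_rfl⟩
      obtain ⟨k, hk⟩ := hk
      obtain ⟨f, hf⟩ := h k
      exact ⟨asg f, fun φ hφ => hk φ hφ f hf⟩
  -- The index, inequality and product formulas turn the satisfying assignment into genuine
  -- epimorphisms; the remaining formulas make these a system.
  have hfib : ∀ i : E.RigidPair, ∃ f : G.carrier →ₜ* i.Quot, Function.Surjective f ∧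
      ∀ b, x (enc ⟨i, b⟩) = fiber f b := fun i =>
    exists_eq_fiber (x := fun b => x (enc ⟨i, b⟩))
      (fun b => (rIdx ⟨i, b⟩ x).1 (hx _ (mIdx _)))
      (fun b c hbc => by
        by_contra hne
        exact (rNe ⟨i, (b, c)⟩ x).1 (hx _ (mNe ⟨i, (b, c)⟩ hne)) hbc)
      (fun b c => (rProd ⟨i, (b, c)⟩ x).1 (hx _ (mProd _)))
  choose f hf hxf using hfib
  have hxasg : x = asg f := by
    funext v
    rw [← enc.apply_symm_apply v, hasg]
    exact hxf _ _
  refine ⟨f, ?_, ?_, ?_⟩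
  · intro i _
    refine isEpi_of_isDeficient hG ((isEpi_quotientMk E.B i.1.1).isDeficient hdef) (hf i) ?_
    intro p
    have hiff : ∀ y : Fin (Nat.card i.Quot) → i.Quot,
        (∃ Γ ∈ G.subgroups (some p), f i '' (Γ : Set G.carrier) = Set.range y) ↔
        ∃ Δ ∈ (E.B.quotient i.1.1).subgroups (some p), ((Δ : Set (E.B.quotient i.1.1).carrier) : Set i.Quot) = Set.range y := by
      intro y
      rw [← hloc p i y (hf i), ← hxasg]
      refine ⟨fun hr => ?_, fun hΔ => hx _ (mLoc p i y hΔ)⟩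
      by_contra hΔ
      exact Formula.realize_not.1 (hx _ (mLocNot p i y hΔ)) hr
    ext D
    -- A subgroup contains 1, so its underlying set is nonempty and can be listed by a tuple y.
    obtain ⟨y, hy⟩ := exists_range_eq (F := i.Quot) ⟨1, one_mem D.toSubgroup⟩
    constructor
    · rintro ⟨Γ, hΓ, rfl⟩
      obtain ⟨Δ, hΔ, hΔy⟩ := (hiff y).1 ⟨Γ, hΓ, hy⟩
      have hΔΓ : Δ = subgrMap (f i) Γ := SetLike.coe_injective (hΔy.trans hy.symm)
      exact hΔΓ ▸ hΔ
    · intro hD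
      obtain ⟨Γ, hΓ, hΓy⟩ := (hiff y).2 ⟨D, hD, hy⟩
      exact ⟨Γ, hΓ, SetLike.coe_injective (hΓy.trans hy.symm)⟩
  · intro i _ g
    have h1 := (rPar ⟨i, f i g⟩ x).1 (hx _ (mPar _))
    rw [hxasg, hasg, coset_fiber (hf i), coset_fiber (hsurjA i)] at h1
    exact (h1 (show f i g = f i g from rfl) : _).symm
  · intro i _ j _ hij g
    have h1 := (rSub (⟨i, f i g⟩, ⟨j, RigidPair.trans hij (f i g)⟩) x).1 (hx _ (mSub i j hij _))
    rw [hxasg, hasg, hasg, coset_fiber (hf i), coset_fiber (hf j)] at h1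
    exact (h1 (show f i g = f i g from rfl) : _).symm

end Cosaturation

end GroupPile

namespace GroupPile

open Pile

variable {S : Type v}

/-! ### The limit of a full system solves the embedding problem -/

namespace EmbeddingProblem

variable {G : GroupPile.{u} S} {E : EmbeddingProblem G}

theorem Rigid.eq_of_forall_rigidPair [Finite S] (hE : E.Rigid) {b c : E.B.carrier}
    (h : ∀ i : E.RigidPair, quotientMk i.1.1 b = quotientMk i.1.1 c) : b = c := by
  refine eq_of_forall_quotientMk fun N => ?_
  obtain ⟨i, hi, -⟩ := hE.exists_rigidPair_le N ⟨⟨⊤, isOpen_univ⟩, inferInstance⟩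
  exact QuotientGroup.eq.2 (hi (QuotientGroup.eq.1 (h i)))

theorem Rigid.nonempty_rigidPair [Finite S] (hE : E.Rigid) : Nonempty E.RigidPair := by
  obtain ⟨k, -⟩ := hE.exists_rigidPair_le ⟨⟨⊤, isOpen_univ⟩, inferInstance⟩
    ⟨⟨⊤, isOpen_univ⟩, inferInstance⟩
  exact ⟨k⟩

/-- In a compact space, a condition that gets stronger along the pairs and can be met at each of
them can be met at all of them. -/
theorem Rigid.exists_forall_rigidPair [Finite S] (hE : E.Rigid) {X : Type*} [TopologicalSpace X]
    [CompactSpace X] {C : E.RigidPair → Set X} (hC : ∀ i, IsClosed (C i))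
    (hne : ∀ i, (C i).Nonempty) (hmono : ∀ i j, i ≤ j → C i ⊆ C j) : ∃ x, ∀ i, x ∈ C i := by
  have := hE.nonempty_rigidPair
  obtain ⟨x, hx⟩ := IsCompact.nonempty_iInter_of_directed_nonempty_isCompact_isClosed C
    (fun i j => by
      obtain ⟨k, hi, hj⟩ := hE.exists_rigidPair_le_le i j
      exact ⟨k, hmono _ _ hi, hmono _ _ hj⟩) hne (fun i => (hC i).isCompact) hC
  exact ⟨x, Set.mem_iInter.1 hx⟩

/-- Compactness of B gives a common lift of the compatible values `f i x`, and cofinality of the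
pairs makes it unique, hence multiplicative in x. Continuity holds because modulo a cofinal family
of N the lift is one of the continuous `f i`. -/
theorem IsSystem.exists_lift [Finite S] (hE : E.Rigid)
    {f : ∀ i : E.RigidPair, G.carrier →ₜ* i.Quot} (hf : IsSystem Set.univ f) :
    ∃ γ : G.carrier →ₜ* E.B.carrier, ∀ i x, quotientMk i.1.1 (γ x) = f i x := by
  have hex : ∀ x, ∃ b : E.B.carrier, ∀ i : E.RigidPair, quotientMk i.1.1 b = f i x := by
    intro x
    refine hE.exists_forall_rigidPair
      (C := fun i : E.RigidPair => {b | quotientMk i.1.1 b = f i x}) ?_ ?_ ?_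
    · exact fun i => isClosed_eq (quotientMk i.1.1).continuous_toFun continuous_const
    · exact fun i => quotientMk_surjective _ _
    · intro i j hij b hb
      have hb' : quotientMk i.1.1 b = f i x := hb
      show quotientMk j.1.1 b = f j x
      rw [← hf.compatible i trivial j trivial hij, ← hb', RigidPair.trans_mk]
  choose γ hγ using hex
  let γ' : G.carrier →* E.B.carrier := MonoidHom.mk' γ fun x y =>
    hE.eq_of_forall_rigidPair fun i => by rw [hγ, map_mul, map_mul, hγ, hγ]
  refine ⟨⟨γ', ?_⟩, fun i x => hγ x i⟩
  refine continuous_of_continuousAt_one γ' ?_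
  rw [ContinuousAt, map_one]
  intro U hU
  obtain ⟨W, hWU, hW, h1⟩ := mem_nhds_iff.1 hU
  obtain ⟨N, hN⟩ := ProfiniteGrp.exist_openNormalSubgroup_sub_open_nhds_of_one hW h1
  obtain ⟨i, hi, -⟩ := hE.exists_rigidPair_le N ⟨⟨⊤, isOpen_univ⟩, inferInstance⟩
  refine Filter.mem_map.2 <| Filter.mem_of_superset ((kerOpenNormal (f i)).isOpen'.mem_nhds
    (one_mem (kerOpenNormal (f i)).toSubgroup)) fun x hx => hWU (hN (hi ?_))
  have hx' : f i x = 1 := hx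
  exact quotientMk_eq_one_iff.1 ((hγ x i).trans hx')

/-- Every equality to be checked holds at each finite level. Preimages of elements and of local
subgroups are found by compactness, of G and of its closed set 𝒢_p respectively. -/
theorem IsSystem.solvable [Finite S] (hE : E.Rigid) (hG : G.IsDeficient) (hdef : E.Deficient)
    {f : ∀ i : E.RigidPair, G.carrier →ₜ* i.Quot} (hf : IsSystem Set.univ f) : E.Solvable := by
  obtain ⟨γ, hγ⟩ := hf.exists_lift hE
  have hcomp : ∀ i : E.RigidPair, (quotientMk i.1.1).comp γ = f i := fun i =>
    ContinuousMonoidHom.ext (hγ i)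
  refine ⟨γ, isEpi_of_isDeficient hG hdef ?_ ?_, ?_⟩
  · intro b
    obtain ⟨x, hx⟩ := hE.exists_forall_rigidPair
      (C := fun i : E.RigidPair => {x | f i x = quotientMk i.1.1 b})
      (fun i => isClosed_eq (f i).continuous_toFun continuous_const)
      (fun i => (hf.isEpi i trivial).1 _) (by
        intro i j hij x hx
        have hx' : f i x = quotientMk i.1.1 b := hx
        show f j x = quotientMk j.1.1 b
        rw [← hf.compatible i trivial j trivial hij, hx', RigidPair.trans_mk])
    exact ⟨x, hE.eq_of_forall_rigidPair fun i => (hγ i x).trans (hx i)⟩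
  · intro p
    have hsub : ∀ (i : E.RigidPair) (Γ : ClosedSubgroup G.carrier),
        subgrMap (quotientMk i.1.1) (subgrMap γ Γ) = subgrMap (f i) Γ := fun i Γ => by
      rw [← subgrMap_comp, hcomp]
    have htrans : ∀ (i j : E.RigidPair), i ≤ j → ∀ {Δ Δ' : ClosedSubgroup E.B.carrier},
        subgrMap (quotientMk i.1.1) Δ = subgrMap (quotientMk i.1.1) Δ' →
        subgrMap (quotientMk j.1.1) Δ = subgrMap (quotientMk j.1.1) Δ' := by
      intro i j hij Δ Δ' h
      exact subgrMap_quotientMk_eq_iff.2 (sup_eq_sup_of_le hij.1 (subgrMap_quotientMk_eq_iff.1 h))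
    apply Set.Subset.antisymm
    -- Modulo every N the image γ(Γ) agrees with a local subgroup of B, so it belongs to the closed
    -- set of local subgroups.
    · rintro _ ⟨Γ, hΓ, rfl⟩
      rw [← (E.B.isClosed_subgroups (some p)).closure_eq,
        mem_closure_iff_nhds_basis (hasBasis_nhds_closedSubgroup _)]
      intro N _
      obtain ⟨i, hi, -⟩ := hE.exists_rigidPair_le N ⟨⟨⊤, isOpen_univ⟩, inferInstance⟩
      have hm : subgrMap (f i) Γ ∈ (E.B.quotient i.1.1).subgroups (some p) :=
        (hf.isEpi i trivial).2 (some p) ▸ Set.mem_image_of_mem _ hΓ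
      obtain ⟨Δ, hΔ, h⟩ := hm
      refine ⟨Δ, hΔ, sup_eq_sup_of_le hi (subgrMap_quotientMk_eq_iff.1 ?_)⟩
      rw [hsub]
      exact h
    · intro Δ hΔ
      -- The compact space here is Subgr(G): one Γ in 𝒢_p is needed that maps to the image of Δ at
      -- all levels at once.
      obtain ⟨Γ, hΓ⟩ := hE.exists_forall_rigidPair
        (C := fun i : E.RigidPair => G.subgroups (some p) ∩
          {Γ | subgrMap (f i) Γ = subgrMap (quotientMk i.1.1) Δ})
        (fun i => (G.isClosed_subgroups (some p)).inter (by
          have := discreteTopology_closedSubgroup (G := i.Quot)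
          exact isClosed_eq (continuous_subgrMap (f i)) continuous_const))
        (fun i => by
          have hm : subgrMap (quotientMk i.1.1) Δ ∈ (E.B.quotient i.1.1).subgroups (some p) :=
            ⟨Δ, hΔ, rfl⟩
          rw [← (hf.isEpi i trivial).2 (some p)] at hm
          exact hm)
        (by
          rintro i j hij Γ ⟨hΓ, h⟩
          refine ⟨hΓ, ?_⟩
          have h' : subgrMap (f i) Γ = subgrMap (quotientMk i.1.1) Δ := h
          rw [← hsub] at h'
          show subgrMap (f j) Γ = subgrMap (quotientMk j.1.1) Δ
          rw [← hsub]
          exact htrans i j hij h')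
      obtain ⟨i₀⟩ := hE.nonempty_rigidPair
      refine ⟨Γ, (hΓ i₀).1, closedSubgroup_eq_of_forall_sup fun N => ?_⟩
      obtain ⟨i, hi, -⟩ := hE.exists_rigidPair_le N ⟨⟨⊤, isOpen_univ⟩, inferInstance⟩
      exact sup_eq_sup_of_le hi
        (subgrMap_quotientMk_eq_iff.1 ((hsub i Γ).trans (hΓ i).2))
  · intro x
    refine eq_of_forall_quotientMk fun L => ?_
    obtain ⟨i, -, hi⟩ := hE.exists_rigidPair_le ⟨⟨⊤, isOpen_univ⟩, inferInstance⟩ L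
    refine QuotientGroup.eq.2 (hi (QuotientGroup.eq.1 ?_))
    show quotientMk i.1.2 (E.α (γ x)) = quotientMk i.1.2 (E.φ x)
    rw [← hf.solves i trivial, ← hγ, RigidPair.hom_mk]

end EmbeddingProblem

end GroupPile

/-! ### The proposition -/

theorem mainTheorem6 {S : Type v} [Finite S] (e : ℕ) (G : GroupPile.{u} S)
    (hC : G.IsFreeCPile e) (hsat : G.IsCosaturated (Cardinal.aleph 1 : Cardinal.{0}))
    (E : G.EmbeddingProblem) (hrigid : E.Rigid) (hgen : E.EGenerated e)
    (hdef : E.Deficient) (hrank : Pile.RankLE E.B.carrier Cardinal.aleph0) :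
    E.Solvable := by
  obtain ⟨f, hf⟩ := GroupPile.exists_isSystem_univ hrigid hrank hsat hC.2.1 hdef
    (GroupPile.EmbeddingProblem.exists_isSystem_Ici hC hgen hdef)
  exact hf.solvable hrigid hC.2.1 hdef
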